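/- Let $\mathbb{K}$ be a field, $A$ a unital $\mathbb{K}$-algebra and $(\Omega=\bigoplus_n\Omega^n,\mathrm d)$ a differential graded $\mathbb{K}$-algebra with $\Omega^0=A$, with $\Omega^1$ spanned by the elements $a\,\mathrm db$ ($a,b\in A$), and with $\Omega$ generated by $A$ and $\Omega^1$; write $\wedge$ for the product of forms and $\otimes$ for $\otimes_A$. Let $\nabla:\Omega^1\to\Omega^1\otimes\Omega^1$ be a bimodule connection: a $\mathbb{K}$-linear map with $$\nabla(a\omega)=\mathrm da\otimes\omega+a\nabla\omega,\qquad \nabla(\omega a)=(\nabla\omega)a+\sigma(\omega\otimes\mathrm da)$$ for a bimodule map $\sigma:\Omega^1\otimes\Omega^1\to\Omega^1\otimes\Omega^1$. An index $i$ on $\sigma_i$, $\wedge_i$ means that the map is applied to the tensor factors $i,i+1$. Put $\nabla_0=\mathrm d$, $\nabla_1=\nabla$ and $\nabla_n=\nabla\otimes\mathrm{id}^{n-1}+\sigma_1(\mathrm{id}\otimes\nabla_{n-1})$ on $(\Omega^1)^{\otimes n}$. Assume that $\nabla$ is - torsion free: $\wedge\nabla=\mathrm d$ on $\Omega^1$;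 - flat: $(\mathrm d\otimes\mathrm{id}-\mathrm{id}\wedge\nabla)\nabla=0$; - $\wedge$-compatible: $\eta\wedge\omega\mapsto(\nabla\eta)\wedge\omega+\wedge_2\sigma_1(\eta\otimes\nabla\omega)$ is a well-defined bimodule connection on $\Omega^2$; - extendable: $\omega\otimes(\eta\wedge\zeta)\mapsto\wedge_1\sigma_2\sigma_1(\omega\otimes\eta\otimes\zeta)$ is a well-defined bimodule map $\Omega^1\otimes\Omega^2\to\Omega^2\otimes\Omega^1$; - Leibniz-compatible: $\nabla_2\sigma_1=\sigma_2\nabla_2$ on $\Omega^1\otimes\Omega^1$. Define $\nabla^0=\mathrm{id}_A$ and $\nabla^{i+1}=\nabla_i\nabla^i:A\to(\Omega^1)^{\otimes(i+1)}$. Define $\Omega^n_S=\bigcap_{1\le i<n}\ker\wedge_i\subseteq(\Omega^1)^{\otimes n}$, so that $\Omega^0_S=A$ and $\Omega^1_S=\Omega^1$. The braided binomials on $(\Omega^1)^{\otimes n}$ are given by $\left[{n\atop0},\sigma\right]=\left[{n\atop n},\sigma\right]=\mathrm{id}$ and $$\left[{n\atop k},\sigma\right]=\Big(\mathrm{id}\otimes\left[{n-1\atop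 k-1},\sigma\right]\Big)\sigma_1\cdots\sigma_{n-k}+\mathrm{id}\otimes\left[{n-1\atop k},\sigma\right]\qquad(0<k<n),$$ and $\omega\odot\eta=\left[{i+j\atop j},\sigma\right](\omega\otimes\eta)$ for $\omega\in\Omega_S^i$, $\eta\in\Omega_S^j$, extended biadditively. Let $\mathcal J^k_A=\bigoplus_{i=0}^k\Omega^i_S$ and $j^k(s)=\sum_{i=0}^k\nabla^is$ for $s\in A$. Then for every $k\ge0$ the map $j^k$ takes values in $\mathcal J^k_A$, and $$a\bullet_k\omega_j=j^{k-j}(a)\odot\omega_j=\sum_{i=j}^k\nabla^{i-j}a\odot\omega_j,\qquad \omega_j\bullet_ka=\omega_j\odot j^{k-j}(a)=\sum_{i=j}^k\omega_j\odot\nabla^{i-j}a$$ ($a\in A$, $\omega_j\in\Omega^j_S$, $0\le j\le k$) make $\mathcal J^k_A$ an $A$-bimodule for which $j^k:A\to\mathcal J^k_A$ is a bimodule map. For $k\ge1$, quotienting out $\Omega^k_S$ gives a surjective bimodule map $\pi_k:\mathcal J^k_A\to\mathcal J^{k-1}_A$ (for the actions $\bullet_k$, $\bullet_{k-1}$) with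 $\pi_k\circ j^k=j^{k-1}$. -/

import Mathlib

open scoped TensorProduct DirectSum
open MulOpposite

universe w u

namespace NCJet

/-! ### Bimodules over a noncommutative algebra, and their tensor product -/

/-- An `A`-bimodule over the field `𝕜`: commuting left and right actions of `A`
(the right action is written as an action of `Aᵐᵒᵖ`, so that `m a` is `op a • m`), which both
restrict to the same action of `𝕜`. -/
structure Bimodule (𝕜 : Type w) (A : Type u) [Field 𝕜] [Ring A] [Algebra 𝕜 A] where
  carrier : Type u
  [addCommGroup : AddCommGroup carrier]
  [base : Module 𝕜 carrier]
  [left : Module A carrier]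
  [right : Module Aᵐᵒᵖ carrier]
  [comm : SMulCommClass A Aᵐᵒᵖ carrier]
  [towerLeft : IsScalarTower 𝕜 A carrier]
  [towerRight : IsScalarTower 𝕜 Aᵐᵒᵖ carrier]

instance (𝕜 : Type w) (A : Type u) [Field 𝕜] [Ring A] [Algebra 𝕜 A] :
    CoeSort (Bimodule 𝕜 A) (Type u) := ⟨Bimodule.carrier⟩

attribute [instance] Bimodule.addCommGroup Bimodule.base Bimodule.left Bimodule.right
  Bimodule.comm Bimodule.towerLeft Bimodule.towerRight

section

variable {𝕜 : Type w} {A : Type u} [Field 𝕜] [Ring A] [Algebra 𝕜 A]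

/-- Bimodule maps. -/
structure BimoduleHom (M N : Bimodule 𝕜 A) extends M →ₗ[𝕜] N where
  map_left : ∀ (a : A) (m : M), toLinearMap (a • m) = a • toLinearMap m
  map_right : ∀ (a : A) (m : M), toLinearMap (op a • m) = op a • toLinearMap m

instance (M N : Bimodule 𝕜 A) : CoeFun (BimoduleHom M N) (fun _ => M → N) :=
  ⟨fun f => f.toLinearMap⟩

/-- The algebra `A` as a bimodule over itself. -/
def regular (𝕜 : Type w) (A : Type u) [Field 𝕜] [Ring A] [Algebra 𝕜 A] : Bimodule 𝕜 A where
  carrier := A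

/-- The zero bimodule. -/
def zeroBimodule (𝕜 : Type w) (A : Type u) [Field 𝕜] [Ring A] [Algebra 𝕜 A] :
    Bimodule 𝕜 A where
  carrier := PUnit

namespace BimoduleHom

variable {M N P : Bimodule 𝕜 A}

protected def id (M : Bimodule 𝕜 A) : BimoduleHom M M where
  toLinearMap := LinearMap.id
  map_left _ _ := rfl
  map_right _ _ := rfl

protected def zero (M N : Bimodule 𝕜 A) : BimoduleHom M N where
  toLinearMap := 0
  map_left _ _ := by simp
  map_right _ _ := by simp

protected def sum (f g : BimoduleHom M N) : BimoduleHom M N where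
  toLinearMap := f.toLinearMap + g.toLinearMap
  map_left a m := by simp [f.map_left, g.map_left]
  map_right a m := by simp [f.map_right, g.map_right]

protected def comp (g : BimoduleHom N P) (f : BimoduleHom M N) : BimoduleHom M P where
  toLinearMap := g.toLinearMap ∘ₗ f.toLinearMap
  map_left a m := by simp [f.map_left, g.map_left]
  map_right a m := by simp [f.map_right, g.map_right]

end BimoduleHom

/-- The relations `m a ⊗ n = m ⊗ a n`. -/
def balanced (M N : Bimodule 𝕜 A) : Submodule 𝕜 (M ⊗[𝕜] N) :=
  Submodule.span 𝕜
    {t | ∃ (m : M) (a : A) (n : N), t = (op a • m) ⊗ₜ[𝕜] n - m ⊗ₜ[𝕜] (a • n)}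

/-- The underlying space of the tensor product `M ⊗_A N`. -/
def Tens (M N : Bimodule 𝕜 A) : Type u := (M ⊗[𝕜] N) ⧸ balanced M N

namespace Tens

variable {M N : Bimodule 𝕜 A}

instance : AddCommGroup (Tens M N) :=
  inferInstanceAs (AddCommGroup ((M ⊗[𝕜] N) ⧸ balanced M N))

instance : Module 𝕜 (Tens M N) :=
  inferInstanceAs (Module 𝕜 ((M ⊗[𝕜] N) ⧸ balanced M N))

/-- The quotient map `M ⊗_𝕜 N → M ⊗_A N`. -/
def proj (M N : Bimodule 𝕜 A) : (M ⊗[𝕜] N) →ₗ[𝕜] Tens M N := (balanced M N).mkQ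

/-- The class `m ⊗ n` in `M ⊗_A N`. -/
def mk (m : M) (n : N) : Tens M N := proj M N (m ⊗ₜ[𝕜] n)

theorem mk_add_left (m m' : M) (n : N) : mk (m + m') n = mk m n + mk m' n := by
  simp only [mk, TensorProduct.add_tmul, map_add]

theorem mk_add_right (m : M) (n n' : N) : mk m (n + n') = mk m n + mk m n' := by
  simp only [mk, TensorProduct.tmul_add, map_add]

theorem mk_smul_left (c : 𝕜) (m : M) (n : N) : mk (c • m) n = c • mk m n := by
  rw [mk, ← TensorProduct.smul_tmul', map_smul, mk]

theorem mk_smul_right (c : 𝕜) (m : M) (n : N) : mk m (c • n) = c • mk m n := by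
  rw [mk, TensorProduct.tmul_smul, map_smul, mk]

theorem mk_balanced (a : A) (m : M) (n : N) : mk (op a • m) n = mk m (a • n) := by
  rw [← sub_eq_zero]
  unfold mk
  rw [← map_sub]
  exact (Submodule.Quotient.mk_eq_zero _).2 (Submodule.subset_span ⟨m, a, n, rfl⟩)

theorem ind {p : Tens M N → Prop} (x : Tens M N)
    (hz : p 0) (ht : ∀ m n, p (mk m n)) (ha : ∀ x y, p x → p y → p (x + y)) : p x := by
  obtain ⟨y, rfl⟩ : ∃ y, proj M N y = x := Submodule.mkQ_surjective _ x
  induction y using TensorProduct.induction_on with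
  | zero => simpa using hz
  | tmul m n => exact ht m n
  | add y z hy hz => rw [map_add]; exact ha _ _ hy hz

/-- The universal property: a `𝕜`-bilinear map `f` with `f (m a) n = f m (a n)` descends. -/
def desc {P : Type*} [AddCommGroup P] [Module 𝕜 P] (f : M →ₗ[𝕜] N →ₗ[𝕜] P)
    (hf : ∀ (a : A) (m : M) (n : N), f (op a • m) n = f m (a • n)) : Tens M N →ₗ[𝕜] P :=
  (balanced M N).liftQ (TensorProduct.lift f) (by
    unfold balanced
    rw [Submodule.span_le]
    rintro _ ⟨m, a, n, rfl⟩
    simp [hf])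

theorem desc_mk {P : Type*} [AddCommGroup P] [Module 𝕜 P] (f : M →ₗ[𝕜] N →ₗ[𝕜] P)
    (hf : ∀ (a : A) (m : M) (n : N), f (op a • m) n = f m (a • n)) (m : M) (n : N) :
    desc f hf (mk m n) = f m n := rfl

/-- The `𝕜`-bilinear map `(m, n) ↦ m ⊗ n`. -/
def mkHom (M N : Bimodule 𝕜 A) : M →ₗ[𝕜] N →ₗ[𝕜] Tens M N :=
  LinearMap.mk₂ 𝕜 mk mk_add_left mk_smul_left mk_add_right mk_smul_right

/-- The left action of `A` on a bimodule, by `𝕜`-linear maps. -/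
def lact (M : Bimodule 𝕜 A) (a : A) : M →ₗ[𝕜] M where
  toFun m := a • m
  map_add' := smul_add a
  map_smul' c m := by
    rw [RingHom.id_apply, ← algebraMap_smul A c m, ← algebraMap_smul A c (a • m), smul_smul,
      smul_smul, Algebra.commutes]

/-- The right action of `A` on a bimodule, by `𝕜`-linear maps. -/
def ract (M : Bimodule 𝕜 A) (a : A) : M →ₗ[𝕜] M where
  toFun m := op a • m
  map_add' := smul_add (op a)
  map_smul' c m := by
    rw [RingHom.id_apply, ← algebraMap_smul Aᵐᵒᵖ c m, ← algebraMap_smul Aᵐᵒᵖ c (op a • m),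
      smul_smul, smul_smul, Algebra.commutes]

def actLeft (a : A) : Tens M N →ₗ[𝕜] Tens M N :=
  desc ((mkHom M N) ∘ₗ lact M a) (fun b m n => by
    change mk (a • op b • m) n = mk (a • m) (b • n)
    rw [smul_comm a (op b) m, mk_balanced])

def actRight (a : A) : Tens M N →ₗ[𝕜] Tens M N :=
  desc ((mkHom M N).compl₂ (ract N a)) (fun b m n => by
    change mk (op b • m) (op a • n) = mk m (op a • b • n)
    rw [mk_balanced, smul_comm b (op a) n])

theorem actLeft_mk (a : A) (m : M) (n : N) : actLeft a (mk m n) = mk (a • m) n := rfl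

theorem actRight_mk (a : A) (m : M) (n : N) : actRight a (mk m n) = mk m (op a • n) := rfl

instance : Module A (Tens M N) where
  smul a x := actLeft a x
  one_smul x := by
    change actLeft 1 x = x
    induction x using ind with
    | hz => rw [map_zero]
    | ht m n => rw [actLeft_mk, one_smul]
    | ha x y hx hy => rw [map_add, hx, hy]
  mul_smul a b x := by
    change actLeft (a * b) x = actLeft a (actLeft b x)
    induction x using ind with
    | hz => simp only [map_zero]
    | ht m n => simp only [actLeft_mk, mul_smul]
    | ha x y hx hy => simp only [map_add, hx, hy]
  smul_zero a := map_zero (actLeft a)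
  smul_add a := map_add (actLeft a)
  add_smul a b x := by
    change actLeft (a + b) x = actLeft a x + actLeft b x
    induction x using ind with
    | hz => simp only [map_zero, add_zero]
    | ht m n => simp only [actLeft_mk, add_smul, mk_add_left]
    | ha x y hx hy => simp only [map_add, hx, hy]; abel
  zero_smul x := by
    change actLeft 0 x = 0
    induction x using ind with
    | hz => rw [map_zero]
    | ht m n => simpa [actLeft_mk] using mk_smul_left (0 : 𝕜) (0 : M) n
    | ha x y hx hy => rw [map_add, hx, hy, add_zero]

instance : Module Aᵐᵒᵖ (Tens M N) where
  smul a x := actRight (unop a) x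
  one_smul x := by
    change actRight (unop 1) x = x
    induction x using ind with
    | hz => rw [map_zero]
    | ht m n => rw [actRight_mk, op_unop, one_smul]
    | ha x y hx hy => rw [map_add, hx, hy]
  mul_smul a b x := by
    change actRight (unop (a * b)) x = actRight (unop a) (actRight (unop b) x)
    induction x using ind with
    | hz => simp only [map_zero]
    | ht m n => simp only [actRight_mk, op_unop, mul_smul]
    | ha x y hx hy => simp only [map_add, hx, hy]
  smul_zero a := map_zero (actRight (unop a))
  smul_add a := map_add (actRight (unop a))
  add_smul a b x := by
    change actRight (unop (a + b)) x = actRight (unop a) x + actRight (unop b) x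
    induction x using ind with
    | hz => simp only [map_zero, add_zero]
    | ht m n => simp only [actRight_mk, op_unop, add_smul, mk_add_right]
    | ha x y hx hy => simp only [map_add, hx, hy]; abel
  zero_smul x := by
    change actRight (unop 0) x = 0
    induction x using ind with
    | hz => rw [map_zero]
    | ht m n => simpa [actRight_mk] using mk_smul_right (0 : 𝕜) m (0 : N)
    | ha x y hx hy => rw [map_add, hx, hy, add_zero]

theorem smul_mk (a : A) (m : M) (n : N) : a • mk m n = mk (a • m) n := rfl

theorem op_smul_mk (b : Aᵐᵒᵖ) (m : M) (n : N) : b • mk m n = mk m (b • n) := rfl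

instance : SMulCommClass A Aᵐᵒᵖ (Tens M N) where
  smul_comm a b x := by
    induction x using ind with
    | hz => simp only [smul_zero]
    | ht m n => simp only [smul_mk, op_smul_mk]
    | ha x y hx hy => simp only [smul_add, hx, hy]

instance : IsScalarTower 𝕜 A (Tens M N) where
  smul_assoc c a x := by
    induction x using ind with
    | hz => simp only [smul_zero]
    | ht m n => simp only [smul_mk, smul_assoc, mk_smul_left]
    | ha x y hx hy => simp only [smul_add, hx, hy]

instance : IsScalarTower 𝕜 Aᵐᵒᵖ (Tens M N) where
  smul_assoc c b x := by
    induction x using ind with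
    | hz => simp only [smul_zero]
    | ht m n => simp only [op_smul_mk, smul_assoc, mk_smul_right]
    | ha x y hx hy => simp only [smul_add, hx, hy]

end Tens

/-- The tensor product `M ⊗_A N` of bimodules, with left action on `M` and right action on
`N`. -/
def tens (M N : Bimodule 𝕜 A) : Bimodule 𝕜 A where
  carrier := Tens M N

section tens

variable {M M' N N' P : Bimodule 𝕜 A}

/-- The element `m ⊗ n` of the bimodule `M ⊗_A N`. -/
def tmul (m : M) (n : N) : tens M N := Tens.mk m n

theorem tmul_add_left (m m' : M) (n : N) : tmul (m + m') n = tmul m n + tmul m' n :=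
  Tens.mk_add_left m m' n

theorem tmul_add_right (m : M) (n n' : N) : tmul m (n + n') = tmul m n + tmul m n' :=
  Tens.mk_add_right m n n'

theorem tmul_smul_left (c : 𝕜) (m : M) (n : N) : tmul (c • m) n = c • tmul m n :=
  Tens.mk_smul_left c m n

theorem tmul_smul_right (c : 𝕜) (m : M) (n : N) : tmul m (c • n) = c • tmul m n :=
  Tens.mk_smul_right c m n

theorem tmul_balanced (a : A) (m : M) (n : N) : tmul (op a • m) n = tmul m (a • n) :=
  Tens.mk_balanced a m n

theorem smul_tmul (a : A) (m : M) (n : N) : a • tmul m n = tmul (a • m) n := rfl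

theorem op_smul_tmul (b : Aᵐᵒᵖ) (m : M) (n : N) : b • tmul m n = tmul m (b • n) := rfl

theorem tens_induction {p : tens M N → Prop} (x : tens M N)
    (hz : p 0) (ht : ∀ m n, p (tmul m n)) (ha : ∀ x y, p x → p y → p (x + y)) : p x :=
  Tens.ind x hz ht ha

/-- The universal property of `M ⊗_A N`: a `𝕜`-bilinear map `f` with `f (m a) n = f m (a n)`
descends to `M ⊗_A N`. -/
def lift {P : Type*} [AddCommGroup P] [Module 𝕜 P] (f : M →ₗ[𝕜] N →ₗ[𝕜] P)
    (hf : ∀ (a : A) (m : M) (n : N), f (op a • m) n = f m (a • n)) : tens M N →ₗ[𝕜] P :=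
  Tens.desc f hf

@[simp]
theorem lift_tmul {P : Type*} [AddCommGroup P] [Module 𝕜 P] (f : M →ₗ[𝕜] N →ₗ[𝕜] P)
    (hf : ∀ (a : A) (m : M) (n : N), f (op a • m) n = f m (a • n)) (m : M) (n : N) :
    lift f hf (tmul m n) = f m n := rfl

/-- The `𝕜`-bilinear map `(m, n) ↦ m ⊗ n`. -/
def tmulHom (M N : Bimodule 𝕜 A) : M →ₗ[𝕜] N →ₗ[𝕜] tens M N :=
  LinearMap.mk₂ 𝕜 tmul tmul_add_left tmul_smul_left tmul_add_right tmul_smul_right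

@[simp]
theorem tmulHom_apply (m : M) (n : N) : tmulHom M N m n = tmul m n := rfl

/-- A `𝕜`-linear map out of `M ⊗_A N` which is left and right `A`-linear on the elements
`m ⊗ n` is a bimodule map. -/
def homOfTmul (f : tens M N →ₗ[𝕜] P) (hl : ∀ (a : A) m n, f (tmul (a • m) n) = a • f (tmul m n))
    (hr : ∀ (a : A) m n, f (tmul m (op a • n)) = op a • f (tmul m n)) :
    BimoduleHom (tens M N) P where
  toLinearMap := f
  map_left a x := by
    induction x using tens_induction with
    | hz => simp only [smul_zero, map_zero]
    | ht m n => rw [smul_tmul, hl]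
    | ha x y hx hy => simp only [smul_add, map_add, hx, hy]
  map_right a x := by
    induction x using tens_induction with
    | hz => simp only [smul_zero, map_zero]
    | ht m n => rw [op_smul_tmul, hr]
    | ha x y hx hy => simp only [smul_add, map_add, hx, hy]

/-- `f ⊗ g : M ⊗_A N → M' ⊗_A N'` for bimodule maps `f`, `g`. -/
def tensMap (f : BimoduleHom M M') (g : BimoduleHom N N') :
    BimoduleHom (tens M N) (tens M' N') :=
  homOfTmul (lift ((tmulHom M' N').compl₁₂ f.toLinearMap g.toLinearMap) (fun a m n => by
    simp [f.map_right, g.map_left, tmul_balanced]))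
    (fun a m n => by simp [f.map_left, smul_tmul])
    (fun a m n => by simp [g.map_right, op_smul_tmul])

/-- `(m ⊗ n) ⊗ p ↦ m ⊗ (n ⊗ p)`. -/
def assocR (M N P : Bimodule 𝕜 A) :
    BimoduleHom (tens (tens M N) P) (tens M (tens N P)) :=
  homOfTmul
    (lift (lift ((LinearMap.llcomp 𝕜 P (tens N P) (tens M (tens N P))).compl₁₂
        (tmulHom M (tens N P)) (tmulHom N P))
      (fun a m n => by
        ext p
        simp [LinearMap.llcomp_apply, tmul_balanced, smul_tmul]))
      (fun a x p => by
        induction x using tens_induction with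
        | hz => simp only [smul_zero, map_zero, LinearMap.zero_apply]
        | ht m n => simp [op_smul_tmul, LinearMap.llcomp_apply, tmul_balanced]
        | ha x y hx hy => simp only [smul_add, map_add, LinearMap.add_apply, hx, hy]))
    (fun a x p => by
      induction x using tens_induction with
      | hz => simp
      | ht m n => simp [smul_tmul, LinearMap.llcomp_apply]
      | ha x y hx hy =>
        simp only [smul_add, tmul_add_left, map_add, hx, hy])
    (fun a x p => by
      induction x using tens_induction with
      | hz => simp
      | ht m n => simp [op_smul_tmul, LinearMap.llcomp_apply]
      | ha x y hx hy =>
        simp only [smul_add, tmul_add_left, map_add, hx, hy])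

/-- `m ⊗ (n ⊗ p) ↦ (m ⊗ n) ⊗ p`. -/
def assocL (M N P : Bimodule 𝕜 A) :
    BimoduleHom (tens M (tens N P)) (tens (tens M N) P) :=
  homOfTmul
    (lift (lift (LinearMap.mk₂ 𝕜
        (fun n p => (tmulHom (tens M N) P).flip p ∘ₗ (tmulHom M N).flip n)
        (fun n n' p => by ext m; simp)
        (fun c n p => by ext m; simp)
        (fun n p p' => by ext m; simp)
        (fun c n p => by ext m; simp))
      (fun a n p => by
        ext m
        simp [← op_smul_tmul, tmul_balanced])).flip
      (fun a m x => by
        induction x using tens_induction with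
        | hz => simp only [smul_zero, map_zero]
        | ht n p => simp [smul_tmul, tmul_balanced]
        | ha x y hx hy => simp only [smul_add, map_add, hx, hy]))
    (fun a m x => by
      induction x using tens_induction with
      | hz => simp
      | ht n p => simp [smul_tmul]
      | ha x y hx hy => simp only [tmul_add_right, map_add, smul_add, hx, hy])
    (fun a m x => by
      induction x using tens_induction with
      | hz => simp
      | ht n p => simp [op_smul_tmul]
      | ha x y hx hy => simp only [tmul_add_right, map_add, smul_add, hx, hy])

theorem assocR_tmul (m : M) (n : N) (p : P) :
    assocR M N P (tmul (tmul m n) p) = tmul m (tmul n p) := rfl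

theorem assocL_tmul (m : M) (n : N) (p : P) :
    assocL M N P (tmul m (tmul n p)) = tmul (tmul m n) p := rfl

theorem tensMap_tmul (f : BimoduleHom M M') (g : BimoduleHom N N') (m : M) (n : N) :
    tensMap f g (tmul m n) = tmul (f m) (g n) := rfl

/-- The left action as a bilinear map. -/
def lactHom (M : Bimodule 𝕜 A) : A →ₗ[𝕜] M →ₗ[𝕜] M :=
  LinearMap.mk₂ 𝕜 (fun a m => a • m)
    (fun a b m => add_smul a b m) (fun c a m => smul_assoc c a m)
    (fun a m n => smul_add a m n) (fun c a m => map_smul (Tens.lact M a) c m)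

/-- The right action as a bilinear map. -/
def ractHom (M : Bimodule 𝕜 A) : M →ₗ[𝕜] A →ₗ[𝕜] M :=
  LinearMap.mk₂ 𝕜 (fun m a => op a • m)
    (fun m n a => smul_add (op a) m n) (fun c m a => map_smul (Tens.ract M a) c m)
    (fun m a b => add_smul (op a) (op b) m)
    (fun c m a => smul_assoc c (op a) m)

/-- The left unitor `A ⊗_A M → M`, `a ⊗ m ↦ a m`. -/
def unitL (M : Bimodule 𝕜 A) : BimoduleHom (tens (regular 𝕜 A) M) M :=
  homOfTmul
    (lift (M := regular 𝕜 A) (lactHom M) (fun b (a : A) m => mul_smul a b m))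
    (fun a (b : A) m => mul_smul a b m)
    (fun a (b : A) m => smul_comm b (op a) m)

/-- The right unitor `M ⊗_A A → M`, `m ⊗ a ↦ m a`. -/
def unitR (M : Bimodule 𝕜 A) : BimoduleHom (tens M (regular 𝕜 A)) M :=
  homOfTmul
    (lift (N := regular 𝕜 A) (ractHom M) (fun b m (a : A) => (mul_smul (op a) (op b) m).symm))
    (fun a m (b : A) => (smul_comm a (op b) m).symm)
    (fun a m (b : A) => mul_smul (op a) (op b) m)

/-- The unit of `A`, as an element of the regular bimodule. -/
def regularOne (𝕜 : Type w) (A : Type u) [Field 𝕜] [Ring A] [Algebra 𝕜 A] : regular 𝕜 A :=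
  (1 : A)

theorem tmul_smul_regularOne (a : A) (m : M) :
    tmul (op a • m) (regularOne 𝕜 A) = tmul (N := regular 𝕜 A) m a := by
  rw [tmul_balanced]
  exact congrArg (tmul (N := regular 𝕜 A) m) (mul_one a)

/-- `M ⊗_A A` is `M`. -/
theorem unitR_bijective (M : Bimodule 𝕜 A) : Function.Bijective (unitR M) := by
  refine Function.bijective_iff_has_inverse.2
    ⟨(tmulHom M (regular 𝕜 A)).flip (regularOne 𝕜 A), fun x => ?_, fun m => ?_⟩
  · induction x using tens_induction with
    | hz => rw [map_zero, map_zero]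
    | ht m a => exact tmul_smul_regularOne _ m
    | ha x y hx hy => rw [map_add, map_add, hx, hy]
  · exact one_smul Aᵐᵒᵖ m

theorem BimoduleHom.ext {f g : BimoduleHom M N} (h : ∀ x, f x = g x) : f = g := by
  cases f
  cases g
  congr
  exact LinearMap.ext h

theorem tensMap_id : tensMap (BimoduleHom.id M) (BimoduleHom.id N) = BimoduleHom.id _ := by
  apply BimoduleHom.ext
  intro x
  induction x using tens_induction with
  | hz => rw [map_zero, map_zero]
  | ht m n => rfl
  | ha x y hx hy => rw [map_add, map_add, hx, hy]

theorem tensMap_zero :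
    tensMap (BimoduleHom.id M) (BimoduleHom.zero N P) = BimoduleHom.zero _ _ := by
  apply BimoduleHom.ext
  intro x
  induction x using tens_induction with
  | hz => rw [map_zero, map_zero]
  | ht m n => exact map_zero (tmulHom M P m)
  | ha x y hx hy => rw [map_add, map_add, hx, hy]

end tens

/-! ### Differential graded algebras over `A` -/

/-- A differential graded algebra `(Ω, d)` over `𝕜` with `Ω⁰ = A`, with `Ω¹` spanned by the elements
`a db` and `Ω` generated by `A` and `Ω¹`. -/
structure DGA (𝕜 : Type w) (A : Type u) [Field 𝕜] [Ring A] [Algebra 𝕜 A] where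
  Ω : Type u
  [ring : Ring Ω]
  [algebra : Algebra 𝕜 Ω]
  /-- `gr n` is `Ωⁿ`. -/
  gr : ℕ → Submodule 𝕜 Ω
  [graded : GradedAlgebra gr]
  /-- The identification of `A` with `Ω⁰`. -/
  ι : A →ₐ[𝕜] Ω
  ι_injective : Function.Injective ι
  ι_range : LinearMap.range ι.toLinearMap = gr 0
  d : Ω →ₗ[𝕜] Ω
  d_mem : ∀ n, ∀ x ∈ gr n, d x ∈ gr (n + 1)
  d_d : ∀ x, d (d x) = 0
  d_mul : ∀ n, ∀ x ∈ gr n, ∀ y, d (x * y) = d x * y + (-1) ^ n * (x * d y)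
  span_one : Submodule.span 𝕜 {x | ∃ a b : A, x = ι a * d (ι b)} = gr 1
  generated : Algebra.adjoin 𝕜 ((gr 0 : Set Ω) ∪ gr 1) = ⊤

attribute [instance] DGA.ring DGA.algebra DGA.graded

namespace DGA

variable (C : DGA 𝕜 A)

theorem ι_mem (a : A) : C.ι a ∈ C.gr 0 := by
  rw [← C.ι_range]; exact ⟨a, rfl⟩

theorem ι_mul_mem {n : ℕ} (a : A) {x : C.Ω} (hx : x ∈ C.gr n) : C.ι a * x ∈ C.gr n := by
  have h := SetLike.GradedMul.mul_mem (C.ι_mem a) hx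
  rwa [zero_add] at h

theorem mul_ι_mem {n : ℕ} (a : A) {x : C.Ω} (hx : x ∈ C.gr n) : x * C.ι a ∈ C.gr n :=
  SetLike.GradedMul.mul_mem hx (C.ι_mem a)

/-- The left action of `A` on `Ωⁿ`, by multiplication in `Ω`. -/
abbrev formLeft (n : ℕ) : Module A (C.gr n) where
  smul := fun a x => ⟨C.ι a * x, C.ι_mul_mem a x.2⟩
  one_smul := fun x => Subtype.ext (by
    change C.ι 1 * (x : C.Ω) = x
    rw [map_one, one_mul])
  mul_smul := fun a b x => Subtype.ext (by
    change C.ι (a * b) * (x : C.Ω) = C.ι a * (C.ι b * x)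
    rw [map_mul, mul_assoc])
  smul_zero := fun a => Subtype.ext (mul_zero (C.ι a))
  smul_add := fun a x y => Subtype.ext (mul_add (C.ι a) (x : C.Ω) y)
  add_smul := fun a b x => Subtype.ext (by
    change C.ι (a + b) * (x : C.Ω) = C.ι a * x + C.ι b * x
    rw [map_add, add_mul])
  zero_smul := fun x => Subtype.ext (by
    change C.ι 0 * (x : C.Ω) = 0
    rw [map_zero, zero_mul])

/-- The right action of `A` on `Ωⁿ`, by multiplication in `Ω`. -/
abbrev formRight (n : ℕ) : Module Aᵐᵒᵖ (C.gr n) where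
  smul := fun a x => ⟨x * C.ι (unop a), C.mul_ι_mem (unop a) x.2⟩
  one_smul := fun x => Subtype.ext (by
    change (x : C.Ω) * C.ι 1 = x
    rw [map_one, mul_one])
  mul_smul := fun a b x => Subtype.ext (by
    change (x : C.Ω) * C.ι (unop b * unop a) = x * C.ι (unop b) * C.ι (unop a)
    rw [map_mul, mul_assoc])
  smul_zero := fun a => Subtype.ext (zero_mul (C.ι (unop a)))
  smul_add := fun a x y => Subtype.ext (add_mul (x : C.Ω) y (C.ι (unop a)))
  add_smul := fun a b x => Subtype.ext (by
    change (x : C.Ω) * C.ι (unop a + unop b) = x * C.ι (unop a) + x * C.ι (unop b)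
    rw [map_add, mul_add])
  zero_smul := fun x => Subtype.ext (by
    change (x : C.Ω) * C.ι 0 = 0
    rw [map_zero, mul_zero])

/-- The `A`-bimodule `Ωⁿ`. -/
def form (n : ℕ) : Bimodule 𝕜 A :=
  letI := C.formLeft n
  letI := C.formRight n
  { carrier := C.gr n
    comm := ⟨fun a b x => Subtype.ext (mul_assoc (C.ι a) (x : C.Ω) (C.ι (unop b))).symm⟩
    towerLeft := ⟨fun c a x => Subtype.ext (by
      change C.ι (c • a) * (x : C.Ω) = c • (C.ι a * x)
      rw [map_smul, smul_mul_assoc])⟩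
    towerRight := ⟨fun c a x => Subtype.ext (by
      change (x : C.Ω) * C.ι (c • unop a) = c • (x * C.ι (unop a))
      rw [map_smul, mul_smul_comm])⟩ }

/-- `d : A → Ω¹`. -/
def d₀ : A →ₗ[𝕜] C.form 1 :=
  LinearMap.codRestrict (C.gr 1) (C.d ∘ₗ C.ι.toLinearMap)
    (fun a => C.d_mem 0 _ (C.ι_mem a))

/-- `d : Ω¹ → Ω²`. -/
def d₁ : C.form 1 →ₗ[𝕜] C.form 2 :=
  LinearMap.restrict C.d (C.d_mem 1)

/-- The product `Ω¹ × Ω¹ → Ω²`. -/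
def mul₁ : C.gr 1 →ₗ[𝕜] C.gr 1 →ₗ[𝕜] C.gr 2 :=
  LinearMap.mk₂ 𝕜
    (fun x y => ⟨x * y, SetLike.GradedMul.mul_mem x.2 y.2⟩)
    (fun x x' y => Subtype.ext (add_mul (x : C.Ω) x' y))
    (fun c x y => Subtype.ext (smul_mul_assoc c (x : C.Ω) y))
    (fun x y y' => Subtype.ext (mul_add (x : C.Ω) y y'))
    (fun c x y => Subtype.ext (mul_smul_comm c (x : C.Ω) y))

/-- The wedge product `∧ : Ω¹ ⊗_A Ω¹ → Ω²`. -/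
def wedge : BimoduleHom (tens (C.form 1) (C.form 1)) (C.form 2) :=
  homOfTmul
    (lift (M := C.form 1) (N := C.form 1) C.mul₁ (fun a (x y : C.gr 1) =>
      Subtype.ext (mul_assoc (x : C.Ω) (C.ι a) y)))
    (fun a (x y : C.gr 1) => Subtype.ext (mul_assoc (C.ι a) (x : C.Ω) y))
    (fun a (x y : C.gr 1) => Subtype.ext (mul_assoc (x : C.Ω) y (C.ι a)).symm)

theorem d₀_mul (a b : A) : C.d₀ (a * b) = op b • C.d₀ a + a • C.d₀ b :=
  Subtype.ext (by
    change C.d (C.ι (a * b)) = C.d (C.ι a) * C.ι b + C.ι a * C.d (C.ι b)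
    rw [map_mul, C.d_mul 0 _ (C.ι_mem a), pow_zero, one_mul])

theorem d₁_op_smul (a : A) (x : C.form 1) :
    C.d₁ (op a • x) = op a • C.d₁ x - C.wedge (tmul x (C.d₀ a)) :=
  Subtype.ext (by
    obtain ⟨x, hx⟩ := x
    change C.d (x * C.ι a) = C.d x * C.ι a - x * C.d (C.ι a)
    rw [C.d_mul 1 _ hx, pow_one, neg_mul, one_mul, sub_eq_add_neg])

/-- The tensor powers `(Ω¹)^{⊗_A n}`: they are `A` for `n = 0`, and `Ω¹ ⊗_A (Ω¹)^{⊗_A n}` for `n + 1`.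
In particular the first one is `Ω¹ ⊗_A A`, which is `Ω¹` by the right unitor. -/
@[reducible] def T : ℕ → Bimodule 𝕜 A
  | 0 => regular 𝕜 A
  | n + 1 => tens (C.form 1) (T n)

/-- `∧` on the first two factors, `Ω¹ ⊗_A (Ω¹ ⊗_A N) → Ω² ⊗_A N`. -/
def wedgeFst (N : Bimodule 𝕜 A) :
    BimoduleHom (tens (C.form 1) (tens (C.form 1) N)) (tens (C.form 2) N) :=
  (tensMap C.wedge (BimoduleHom.id N)).comp (assocL _ _ _)

/-- The target of `∧` applied to the factors `i`, `i + 1` (counted from `0`) of `(Ω¹)^{⊗_A n}`, that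
is, `(Ω¹)^{⊗ i} ⊗ Ω² ⊗ (Ω¹)^{⊗ (n - i - 2)}`; a junk value unless `i + 1 < n`. -/
@[reducible] def W : ℕ → ℕ → Bimodule 𝕜 A
  | 0, n + 2 => tens (C.form 2) (C.T n)
  | i + 1, n + 1 => tens (C.form 1) (W i n)
  | 0, 0 => zeroBimodule 𝕜 A
  | 0, 1 => zeroBimodule 𝕜 A
  | _ + 1, 0 => zeroBimodule 𝕜 A

/-- `∧` applied to the factors `i`, `i + 1` (counted from `0`) of `(Ω¹)^{⊗_A n}`, for `i + 1 < n`. -/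
def wedgeAt : ∀ i n : ℕ, BimoduleHom (C.T n) (C.W i n)
  | 0, n + 2 => C.wedgeFst (C.T n)
  | i + 1, n + 1 => tensMap (BimoduleHom.id (C.form 1)) (wedgeAt i n)
  | 0, 0 => BimoduleHom.zero _ _
  | 0, 1 => BimoduleHom.zero _ _
  | _ + 1, 0 => BimoduleHom.zero _ _

/-- The quantum symmetric forms `Ω_S^n`: the joint kernel in `(Ω¹)^{⊗_A n}` of the wedge products
of adjacent factors. -/
def quantumSymmetric (n : ℕ) : Submodule 𝕜 (C.T n) :=
  ⨅ (i : ℕ) (_ : i + 1 < n), LinearMap.ker (C.wedgeAt i n).toLinearMap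

/-- The total space of the tensor powers of `Ω¹`. -/
abbrev Total : Type u := ⨁ n, C.T n

/-- The inclusion of `(Ω¹)^{⊗_A n}` into the total space. -/
abbrev incl (n : ℕ) : C.T n →ₗ[𝕜] C.Total := DirectSum.lof 𝕜 ℕ (fun n => C.T n) n

/-- The underlying space of the `k`-th jet bimodule, `⨁_{i ≤ k} Ω_S^i`, inside the total space. -/
def jetSpace (k : ℕ) : Submodule 𝕜 C.Total where
  carrier := {x | (∀ i, x i ∈ C.quantumSymmetric i) ∧ ∀ i, k < i → x i = 0}
  add_mem' := fun {x y} hx hy => ⟨fun i => add_mem (hx.1 i) (hy.1 i), fun i hi => by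
    rw [DirectSum.add_apply, hx.2 i hi, hy.2 i hi, add_zero]⟩
  zero_mem' := ⟨fun i => zero_mem _, fun i _ => rfl⟩
  smul_mem' := fun c x hx => ⟨fun i => Submodule.smul_mem _ c (hx.1 i), fun i hi => by
    rw [DirectSum.smul_apply, hx.2 i hi, smul_zero]⟩

theorem incl_mem_jetSpace {k j : ℕ} (h : j ≤ k) {x : C.T j} (hx : x ∈ C.quantumSymmetric j) :
    C.incl j x ∈ C.jetSpace k := by
  have h0 : ∀ i, i ≠ j → C.incl j x i = 0 := fun i hij =>
    DFinsupp.single_eq_of_ne (β := fun n => C.T n) hij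
  refine ⟨fun i => ?_, fun i hi => h0 i (by omega)⟩
  by_cases hij : i = j
  · subst hij
    rw [DirectSum.lof_apply]
    exact hx
  · rw [h0 i hij]
    exact zero_mem _

/-- The inclusion of `Ω_S^j` into `⨁_{i ≤ k} Ω_S^i`, for `j ≤ k`. -/
def jetIncl {k j : ℕ} (h : j ≤ k) : C.quantumSymmetric j →ₗ[𝕜] C.jetSpace k :=
  LinearMap.restrict (C.incl j) (fun _ hx => C.incl_mem_jetSpace h hx)

/-- The concatenation map `(Ω¹)^{⊗ i} ⊗_A (Ω¹)^{⊗ j} → (Ω¹)^{⊗ (i + j)}`; the exponent is written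
`j + i`. -/
def concat (j : ℕ) : ∀ i : ℕ, BimoduleHom (tens (C.T i) (C.T j)) (C.T (j + i))
  | 0 => unitL (C.T j)
  | i + 1 => (tensMap (BimoduleHom.id (C.form 1)) (concat j i)).comp (assocR _ _ _)

end DGA

/-! ### Connections -/

/-- A left connection on a left module: here `N` is a bimodule and `∇ : N → Ω¹ ⊗_A N` satisfies
`∇(a n) = da ⊗ n + a ∇n`. -/
structure LeftConnection (C : DGA 𝕜 A) (N : Bimodule 𝕜 A) extends
    N →ₗ[𝕜] tens (C.form 1) N where
  leibniz : ∀ (a : A) (n : N),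
    toLinearMap (a • n) = tmul (C.d₀ a) n + a • toLinearMap n

instance (C : DGA 𝕜 A) (N : Bimodule 𝕜 A) :
    CoeFun (LeftConnection C N) (fun _ => N → tens (C.form 1) N) :=
  ⟨fun f => f.toLinearMap⟩

namespace LeftConnection

variable {C : DGA 𝕜 A} {N : Bimodule 𝕜 A}

/-- A bimodule map `σ : N ⊗_A Ω¹ → Ω¹ ⊗_A N` is a generalised braiding of `∇` if
`∇(n a) = (∇n) a + σ(n ⊗ da)`. -/
def IsBraiding (D : LeftConnection C N)
    (σ : BimoduleHom (tens N (C.form 1)) (tens (C.form 1) N)) : Prop :=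
  ∀ (n : N) (a : A), D (op a • n) = op a • D n + σ (tmul n (C.d₀ a))

/-- `d ⊗ id - id ∧ ∇ : Ω¹ ⊗_A N → Ω² ⊗_A N`. -/
def covExt (D : LeftConnection C N) : tens (C.form 1) N →ₗ[𝕜] tens (C.form 2) N :=
  lift (LinearMap.mk₂ 𝕜
      (fun (x : C.form 1) (n : N) => tmul (C.d₁ x) n - C.wedgeFst N (tmul x (D n)))
      (fun x y n => by simp only [tmul_add_left, map_add]; abel)
      (fun c x n => by simp only [tmul_smul_left, map_smul, smul_sub])
      (fun x m n => by simp only [tmul_add_right, map_add]; abel)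
      (fun c x n => by simp only [tmul_smul_right, map_smul, smul_sub]))
    (fun a x n => by
      simp only [LinearMap.mk₂_apply]
      rw [C.d₁_op_smul, D.leibniz, tmul_add_right, map_add, sub_eq_add_neg (op a • C.d₁ x),
        tmul_add_left, tmul_balanced, tmul_balanced]
      have h : C.wedgeFst N (tmul x (tmul (C.d₀ a) n)) =
          tmul (C.wedge (tmul x (C.d₀ a))) n := rfl
      rw [h]
      have h' : tmul (-C.wedge (tmul x (C.d₀ a))) n = -tmul (C.wedge (tmul x (C.d₀ a))) n :=
        map_neg ((tmulHom (C.form 2) N).flip n) _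
      rw [h']
      abel)

/-- The curvature `R = (d ⊗ id - id ∧ ∇) ∇ : N → Ω² ⊗_A N`. -/
def curvature (D : LeftConnection C N) : N →ₗ[𝕜] tens (C.form 2) N :=
  D.covExt ∘ₗ D.toLinearMap

/-- The connection `d` on `A`, as a map `A → Ω¹ ⊗_A A`, `a ↦ da ⊗ 1`. -/
def trivial (C : DGA 𝕜 A) : LeftConnection C (regular 𝕜 A) where
  toLinearMap := (tmulHom (C.form 1) (regular 𝕜 A)).flip (regularOne 𝕜 A) ∘ₗ C.d₀
  leibniz a (b : A) := by
    change tmul (C.d₀ (a * b)) (regularOne 𝕜 A) =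
      tmul (N := regular 𝕜 A) (C.d₀ a) b + a • tmul (C.d₀ b) (regularOne 𝕜 A)
    rw [C.d₀_mul, tmul_add_left, tmul_smul_regularOne, smul_tmul]

end LeftConnection

/-- A bimodule connection on `Ω¹`: a left connection with a generalised braiding `σ`. -/
structure BimoduleConnection (C : DGA 𝕜 A) extends LeftConnection C (C.form 1) where
  σ : BimoduleHom (tens (C.form 1) (C.form 1)) (tens (C.form 1) (C.form 1))
  isBraiding : toLeftConnection.IsBraiding σ

namespace BimoduleConnection

variable {C : DGA 𝕜 A} (D : BimoduleConnection C)

/-- `∇` as a function `Ω¹ → Ω¹ ⊗_A Ω¹`. -/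
abbrev nabla (x : C.form 1) : tens (C.form 1) (C.form 1) := D.toLeftConnection x

/-- `σ` on the first two factors of `Ω¹ ⊗_A Ω¹ ⊗_A N`. -/
def braidFst (N : Bimodule 𝕜 A) :
    BimoduleHom (tens (C.form 1) (tens (C.form 1) N)) (tens (C.form 1) (tens (C.form 1) N)) :=
  (assocR _ _ _).comp ((tensMap D.σ (BimoduleHom.id N)).comp (assocL _ _ _))

/-- The map `∇ ⊗ id + (σ ⊗ id)(id ⊗ ∇_N)` on `Ω¹ ⊗_A N`. -/
def tensConnFun {N : Bimodule 𝕜 A} (E : LeftConnection C N) :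
    tens (C.form 1) N →ₗ[𝕜] tens (C.form 1) (tens (C.form 1) N) :=
  lift (LinearMap.mk₂ 𝕜
      (fun (x : C.form 1) (n : N) =>
        assocR (C.form 1) (C.form 1) N (tmul (D.nabla x) n) + D.braidFst N (tmul x (E n)))
      (fun x y n => by simp only [tmul_add_left, map_add]; abel)
      (fun c x n => by simp only [tmul_smul_left, map_smul, smul_add])
      (fun x m n => by simp only [tmul_add_right, map_add]; abel)
      (fun c x n => by simp only [tmul_smul_right, map_smul, smul_add]))
    (fun a x n => by
      simp only [LinearMap.mk₂_apply]
      have h : D.braidFst N (tmul x (tmul (C.d₀ a) n)) =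
        assocR (C.form 1) (C.form 1) N (tmul (D.σ (tmul x (C.d₀ a))) n) := rfl
      rw [nabla, D.isBraiding, tmul_add_left, map_add, E.leibniz, tmul_add_right, map_add, h,
        tmul_balanced, tmul_balanced]
      abel)

theorem tensConnFun_tmul {N : Bimodule 𝕜 A} (E : LeftConnection C N) (x : C.form 1) (n : N) :
    D.tensConnFun E (tmul x n) =
      assocR (C.form 1) (C.form 1) N (tmul (D.nabla x) n) + D.braidFst N (tmul x (E n)) := rfl

/-- The tensor product connection `∇ ⊗ id + (σ ⊗ id)(id ⊗ ∇_N)` on `Ω¹ ⊗_A N`. -/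
def tensConn {N : Bimodule 𝕜 A} (E : LeftConnection C N) :
    LeftConnection C (tens (C.form 1) N) where
  toLinearMap := D.tensConnFun E
  leibniz a t := by
    induction t using tens_induction with
    | hz =>
      rw [smul_zero, map_zero, smul_zero, add_zero]
      exact (map_zero (tmulHom (C.form 1) (tens (C.form 1) N) (C.d₀ a))).symm
    | ht x n =>
      have h : assocR (C.form 1) (C.form 1) N (tmul (tmul (C.d₀ a) x) n) =
        tmul (C.d₀ a) (tmul x n) := rfl
      rw [smul_tmul, tensConnFun_tmul, tensConnFun_tmul, nabla, D.leibniz, tmul_add_left,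
        map_add, h, ← smul_tmul, ← smul_tmul, BimoduleHom.map_left, BimoduleHom.map_left,
        smul_add, add_assoc]
    | ha x y hx hy =>
      rw [smul_add, map_add, map_add, hx, hy, tmul_add_right, smul_add]
      abel

/-- `∇` is torsion free: `∧ ∇ = d`. -/
def TorsionFree : Prop := ∀ x : C.form 1, C.wedge (D.nabla x) = C.d₁ x

/-- `∇` is flat: its curvature vanishes. -/
def Flat : Prop := D.toLeftConnection.curvature = 0

/-- `∇` is `∧`-compatible: `∇_{Ω²}(η ∧ ω) = (∇η) ∧ ω + ∧₂ σ₁ (η ⊗ ∇ω)` is a well-defined bimodule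
connection on `Ω²`. -/
def WedgeCompatible : Prop :=
  ∃ (E : LeftConnection C (C.form 2))
    (τ : BimoduleHom (tens (C.form 2) (C.form 1)) (tens (C.form 1) (C.form 2))),
    E.IsBraiding τ ∧ ∀ η ω : C.form 1,
      E (C.wedge (tmul η ω)) =
        tensMap (BimoduleHom.id _) C.wedge
          (assocR _ _ _ (tmul (D.nabla η) ω) + D.braidFst _ (tmul η (D.nabla ω)))

/-- `∇` is extendable: `ω ⊗ (η ∧ ζ) ↦ ∧₁ σ₂ σ₁ (ω ⊗ η ⊗ ζ)` is a well-defined bimodule map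
`Ω¹ ⊗_A Ω² → Ω² ⊗_A Ω¹`. -/
def Extendable : Prop :=
  ∃ τ : BimoduleHom (tens (C.form 1) (C.form 2)) (tens (C.form 2) (C.form 1)),
    ∀ ω η ζ : C.form 1,
      τ (tmul ω (C.wedge (tmul η ζ))) =
        C.wedgeFst _ (tensMap (BimoduleHom.id _) D.σ (D.braidFst _ (tmul ω (tmul η ζ))))

/-- `∇` is Leibniz-compatible: `∇₂ σ₁ = σ₂ ∇₂` on `Ω¹ ⊗_A Ω¹`, where `∇₂` is the tensor product
connection. -/
def LeibnizCompatible : Prop :=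
  ∀ x : tens (C.form 1) (C.form 1),
    D.tensConn D.toLeftConnection (D.σ x) =
      tensMap (BimoduleHom.id _) D.σ (D.tensConn D.toLeftConnection x)

/-- The tensor product connections `∇_n : (Ω¹)^{⊗ n} → Ω¹ ⊗_A (Ω¹)^{⊗ n}`, with `∇₀ = d`. -/
def connAt : ∀ n : ℕ, LeftConnection C (C.T n)
  | 0 => LeftConnection.trivial C
  | n + 1 => D.tensConn (connAt n)

/-- The higher derivatives `∇^i : A → (Ω¹)^{⊗ i}`: `∇⁰ = id`, `∇^{i+1} = ∇_i ∇^i`. -/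
def nablaPow : ∀ i : ℕ, A →ₗ[𝕜] C.T i
  | 0 => LinearMap.id
  | i + 1 => (D.connAt i).toLinearMap ∘ₗ nablaPow i

/-- `σ` applied to the factors `i`, `i + 1` (counted from `0`) of `(Ω¹)^{⊗ n}`, for `i + 1 < n`;
the identity otherwise. -/
def braidAt : ∀ _i n : ℕ, BimoduleHom (C.T n) (C.T n)
  | 0, n + 2 => D.braidFst (C.T n)
  | i + 1, n + 1 => tensMap (BimoduleHom.id (C.form 1)) (braidAt i n)
  | 0, 0 => BimoduleHom.id _
  | 0, 1 => BimoduleHom.id _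
  | _ + 1, 0 => BimoduleHom.id _

/-- `σ₁ σ₂ ⋯ σ_m` on `(Ω¹)^{⊗ n}` (`σ_m` is applied first). -/
def braidRun (n : ℕ) : ℕ → BimoduleHom (C.T n) (C.T n)
  | 0 => BimoduleHom.id _
  | m + 1 => (braidRun n m).comp (D.braidAt m n)

/-- The braided binomials `[n ; k, σ]` on `(Ω¹)^{⊗ n}`; those with `n < k` are put equal to `0`, which
makes the recursion
`[n+1 ; k+1] = (id ⊗ [n ; k]) σ₁ ⋯ σ_{n-k} + id ⊗ [n ; k+1]` give `[n ; n] = id`. -/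
def binom : ∀ n _k : ℕ, BimoduleHom (C.T n) (C.T n)
  | _, 0 => BimoduleHom.id _
  | 0, _ + 1 => BimoduleHom.zero _ _
  | n + 1, k + 1 =>
    ((tensMap (BimoduleHom.id (C.form 1)) (binom n k)).comp (D.braidRun (n + 1) (n - k))).sum
      (tensMap (BimoduleHom.id (C.form 1)) (binom n (k + 1)))

theorem binom_of_lt (n : ℕ) : ∀ k, n < k → D.binom n k = BimoduleHom.zero _ _ := by
  induction n with
  | zero =>
    intro k hk
    obtain ⟨k, rfl⟩ := Nat.exists_eq_succ_of_ne_zero hk.ne'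
    rfl
  | succ n ih =>
    intro k hk
    obtain ⟨k, rfl⟩ := Nat.exists_eq_succ_of_ne_zero (by omega : k ≠ 0)
    rw [binom, ih k (by omega), ih (k + 1) (by omega), tensMap_zero]
    apply BimoduleHom.ext
    intro x
    exact add_zero 0

theorem binom_self (n : ℕ) : D.binom n n = BimoduleHom.id _ := by
  induction n with
  | zero => rfl
  | succ n ih =>
    rw [binom, ih, binom_of_lt D n (n + 1) (by omega), tensMap_zero, tensMap_id, Nat.sub_self]
    apply BimoduleHom.ext
    intro x
    exact add_zero x

/-- The product `⊙ = [i + j ; j, σ] : (Ω¹)^{⊗ i} ⊗_A (Ω¹)^{⊗ j} → (Ω¹)^{⊗ (i + j)}`. -/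
def odotAt (i j : ℕ) : BimoduleHom (tens (C.T i) (C.T j)) (C.T (j + i)) :=
  (D.binom (j + i) j).comp (C.concat j i)

/-- The product `⊙` on the total space, bilinearly extended from the homogeneous components. -/
def odot : C.Total →ₗ[𝕜] C.Total →ₗ[𝕜] C.Total :=
  DirectSum.toModule 𝕜 ℕ _ (fun i => LinearMap.flip (DirectSum.toModule 𝕜 ℕ _ (fun j =>
    LinearMap.flip ((tmulHom (C.T i) (C.T j)).compr₂
      (C.incl (j + i) ∘ₗ (D.odotAt i j).toLinearMap)))))

theorem odot_incl (i j : ℕ) (x : C.T i) (y : C.T j) :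
    D.odot (C.incl i x) (C.incl j y) = C.incl (j + i) (D.odotAt i j (tmul x y)) := by
  simp [odot]

/-- The jet prolongation `j^k(s) = ∑_{i ≤ k} ∇^i s`. -/
def jet (k : ℕ) : A →ₗ[𝕜] C.Total :=
  ∑ i ∈ Finset.range (k + 1), C.incl i ∘ₗ D.nablaPow i

end BimoduleConnection

end

end NCJet

/-! The braided binomial [p+q; q] is a sum over the ways of shuffling a block of p letters with a
block of q letters, crossings being made by σ. So ⊙ is a braided shuffle product on the tensor
powers of Ω¹, with unit 1 ∈ A. The theorem follows from three facts: ⊙ is associative, the forms Ω_S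
are closed under ⊙, and s ↦ ∑ ∇^i s takes values in Ω_S and sends products to ⊙-products in each
degree. Dividing by the degrees above k then makes 𝒥^k a unital associative algebra and j^k : A →
𝒥^k a unital algebra map (as d1 = 0). The two actions are multiplication by j^k(a) from either side.
Hence the bimodule axioms are associativity, bimodule linearity of j^k is its multiplicativity, and
π_k is linear because truncation is an algebra map carrying j^k to j^(k-1).

Associativity (`shuf_assoc`) is formal in a ring with an endomorphism `s` (tensoring with id on the
left) and an element σ satisfying the braid relation and commuting with the image of `s²`. The braid
relation is a consequence of Leibniz compatibility: compare the right Leibniz rules of the two sides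
of ∇₂σ₁ = σ₂∇₂.

Multiplicativity (`LeibnizCompatible.pow_mul`) is by induction on the degree. Leibniz compatibility
moves ∇ past a shuffle, at the cost of a shift, and ∇(x ⊗ y) = ∇x ⊗ y + σ₁⋯σ_i(x ⊗ ∇y) for x of
degree i. What results is the recursion of the binomials.

∇^n s is quantum symmetric (`nablaPow_mem_quantumSymmetric`): torsion freeness turns ∧₁∇∇ into
curvature, which vanishes on all tensor powers, while ∧-compatibility lets ∇ descend through the
later ∧_i. Closure under ⊙ (`wedgeAt_comp_shuf_mem`) follows by looking at two adjacent letters of a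
shuffle. If they come from one block, ∧ of them can be taken before shuffling, by extendability or
∧-compatibility. If they come from different blocks, the two orders cancel, since ∧σ = -∧. -/

namespace NCJet

/-! ### Shuffle elements in a ring with a shift and a braiding -/

section ShuffleRing

variable {R : Type*} [Ring R] (s : R →+* R) (σ : R)

/-- The ordered product `σ · s σ ⋯ s^{p-1} σ`. -/
def run : ℕ → R
  | 0 => 1
  | p + 1 => σ * s (run p)

/-- The braided shuffle element of a block of `p` and a block of `q` letters. -/
def shuf : ℕ → ℕ → R
  | 0, _ => 1
  | _ + 1, 0 => 1
  | p + 1, q + 1 => s (shuf (p + 1) q) * run s σ (p + 1) + s (shuf p (q + 1))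
termination_by p q => p + q

theorem run_zero : run s σ 0 = 1 := rfl

theorem run_succ (p : ℕ) : run s σ (p + 1) = σ * s (run s σ p) := rfl

theorem shuf_zero_left (q : ℕ) : shuf s σ 0 q = 1 := by rw [shuf]

theorem shuf_zero_right (p : ℕ) : shuf s σ p 0 = 1 := by cases p <;> rw [shuf]

theorem shuf_succ_succ (p q : ℕ) : shuf s σ (p + 1) (q + 1) =
    s (shuf s σ (p + 1) q) * run s σ (p + 1) + s (shuf s σ p (q + 1)) := by
  rw [shuf]

variable {s σ}

theorem run_add (a b : ℕ) : run s σ (a + b) = run s σ a * s^[a] (run s σ b) := by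
  induction a with
  | zero => simp [run_zero]
  | succ a ih =>
    rw [Nat.succ_add, run_succ, ih, run_succ, map_mul, mul_assoc, Function.iterate_succ_apply']

/-- The run involves only the first a + 1 letters, and a shift by a + 1 acts beyond them. -/
theorem run_mul_iterate (hc : ∀ x, σ * s (s x) = s (s x) * σ) (a : ℕ) (x : R) :
    run s σ a * s^[a + 1] x = s^[a + 1] x * run s σ a := by
  induction a with
  | zero => simp [run_zero]
  | succ a ih =>
    rw [run_succ, Function.iterate_succ_apply', mul_assoc, ← map_mul, ih, map_mul,
      Function.iterate_succ_apply', ← mul_assoc, hc, mul_assoc]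

theorem run_intertwine_shift (hc : ∀ x, σ * s (s x) = s (s x) * σ) {m : ℕ} {x : R}
    (h : s x * run s σ m = run s σ m * x) :
    s (s x) * run s σ (m + 1) = run s σ (m + 1) * s x := by
  rw [run_succ, ← mul_assoc, ← hc, mul_assoc, ← map_mul, h, map_mul, mul_assoc]

/-- The run begins with σ₁σ₂, and its remaining factors act from the third letter on, so they
commute with σ₁. What is left is σ₂σ₁σ₂ = σ₁σ₂σ₁. -/
theorem run_intertwine_braid (hc : ∀ x, σ * s (s x) = s (s x) * σ)
    (hy : σ * s σ * σ = s σ * σ * s σ) (m : ℕ) :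
    s σ * run s σ (m + 2) = run s σ (m + 2) * σ := by
  have h : run s σ (m + 2) = σ * s σ * s (s (run s σ m)) := by
    rw [run_succ, run_succ, map_mul, mul_assoc]
  rw [h, mul_assoc (σ * s σ), ← hc, ← mul_assoc, ← mul_assoc, ← mul_assoc, hy]

theorem run_intertwine_run (hc : ∀ x, σ * s (s x) = s (s x) * σ)
    (hy : σ * s σ * σ = s σ * σ * s σ) (p m : ℕ) (h : p + 1 ≤ m) :
    s (run s σ p) * run s σ m = run s σ m * run s σ p := by
  induction p generalizing m with
  | zero => simp [run_zero]
  | succ p ih =>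
    obtain ⟨m, rfl⟩ := Nat.exists_eq_add_of_le' h
    have h1 := run_intertwine_shift hc (ih (m + p + 1) (by omega))
    rw [run_succ s σ p, map_mul, mul_assoc]
    rw [show m + (p + 1 + 1) = m + p + 1 + 1 by omega, h1, ← mul_assoc,
      run_intertwine_braid hc hy, mul_assoc]

/-- A run carries one letter to the front past m others. Shuffling those m letters before or after
is the same, except that afterwards they sit one place further right. -/
theorem run_intertwine_shuf (hc : ∀ x, σ * s (s x) = s (s x) * σ)
    (hy : σ * s σ * σ = s σ * σ * s σ) (m : ℕ) : ∀ p q : ℕ, p + q ≤ m →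
    s (shuf s σ p q) * run s σ m = run s σ m * shuf s σ p q := by
  induction m with
  | zero =>
    intro p q h
    obtain rfl : p = 0 := by omega
    simp [shuf_zero_left]
  | succ m ih =>
    intro p q h
    rcases p with _ | p
    · simp [shuf_zero_left]
    rcases q with _ | q
    · simp [shuf_zero_right]
    rw [shuf_succ_succ, map_add, map_mul, add_mul, mul_add, mul_assoc,
      run_intertwine_run hc hy _ _ (by omega), ← mul_assoc,
      run_intertwine_shift hc (ih _ _ (by omega)), mul_assoc,
      run_intertwine_shift hc (ih _ _ (by omega))]

/-- Associativity of the braided shuffle product. -/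
theorem shuf_assoc (hc : ∀ x, σ * s (s x) = s (s x) * σ)
    (hy : σ * s σ * σ = s σ * σ * s σ) (n : ℕ) : ∀ a b c : ℕ, a + b + c = n →
    shuf s σ (a + b) c * shuf s σ a b = shuf s σ a (b + c) * s^[a] (shuf s σ b c) := by
  induction n with
  | zero =>
    intro a b c h
    obtain ⟨rfl, rfl, rfl⟩ : a = 0 ∧ b = 0 ∧ c = 0 := by omega
    simp [shuf_zero_left]
  | succ n ih =>
    intro a b c h
    rcases a with _ | a
    · simp [shuf_zero_left]
    rcases b with _ | b
    · simp [shuf_zero_left, shuf_zero_right]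
    rcases c with _ | c
    · simp [shuf_zero_right]
    -- The three instances remove the letter that ends up first, taken from the third, second and
    -- first block respectively. Both sides are expanded into these three sums and matched.
    have h1 := ih (a + 1) (b + 1) c (by omega)
    have h2 := ih (a + 1) b (c + 1) (by omega)
    have h3 := ih a (b + 1) (c + 1) (by omega)
    have e1 : shuf s σ (a + 1 + (b + 1)) (c + 1) =
        s (shuf s σ (a + 1 + (b + 1)) c) * run s σ (a + 1 + (b + 1)) +
          s (shuf s σ (a + 1 + b) (c + 1)) := shuf_succ_succ s σ _ _
    have e2 : shuf s σ (a + 1) (b + 1 + (c + 1)) =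
        s (shuf s σ (a + 1) (b + 1 + c)) * run s σ (a + 1) +
          s (shuf s σ a (b + 1 + (c + 1))) := shuf_succ_succ s σ _ _
    have l1 : s (shuf s σ (a + 1 + (b + 1)) c) * run s σ (a + 1 + (b + 1)) *
        shuf s σ (a + 1) (b + 1) =
        s (shuf s σ (a + 1) (b + 1 + c)) * s^[a + 2] (shuf s σ (b + 1) c) *
          run s σ (a + 1 + (b + 1)) := by
      rw [mul_assoc, ← run_intertwine_shuf hc hy _ _ _ le_rfl, ← mul_assoc, ← map_mul, h1,
        map_mul, Function.iterate_succ_apply' s (a + 1)]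
    have l2 : s (shuf s σ (a + 1 + b) (c + 1)) * shuf s σ (a + 1) (b + 1) =
        s (shuf s σ (a + 1) (b + 1 + c)) * s^[a + 2] (shuf s σ b (c + 1)) * run s σ (a + 1) +
          s (shuf s σ a (b + 1 + (c + 1))) * s^[a + 1] (shuf s σ (b + 1) (c + 1)) := by
      have e : b + (c + 1) = b + 1 + c := by omega
      have e' : a + 1 + b = a + (b + 1) := by omega
      rw [shuf_succ_succ s σ a b, mul_add, ← mul_assoc, ← map_mul, h2, e', ← map_mul, h3, map_mul,
        map_mul, e, Function.iterate_succ_apply' s (a + 1),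
        Function.iterate_succ_apply' s a (shuf s σ (b + 1) (c + 1))]
    have r1 : run s σ (a + 1) * s^[a + 1] (shuf s σ (b + 1) (c + 1)) =
        s^[a + 2] (shuf s σ (b + 1) c) * run s σ (a + 1 + (b + 1)) +
          s^[a + 2] (shuf s σ b (c + 1)) * run s σ (a + 1) := by
      rw [shuf_succ_succ, iterate_map_add, iterate_map_mul, mul_add, ← mul_assoc,
        ← Function.iterate_succ_apply, ← Function.iterate_succ_apply,
        run_mul_iterate hc, run_mul_iterate hc, mul_assoc, ← run_add]
    rw [e1, add_mul, l1, l2, e2, add_mul,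
      mul_assoc (s (shuf s σ (a + 1) (b + 1 + c))) (run s σ (a + 1)),
      r1, mul_add]
    simp only [mul_assoc, add_assoc]

end ShuffleRing

/-! ### Tensoring with left linear maps -/

section

variable {𝕜 : Type w} {A : Type u} [Field 𝕜] [Ring A] [Algebra 𝕜 A]

/-- A bimodule map as a left `A`-linear map. -/
def BimoduleHom.lin {M N : Bimodule 𝕜 A} (f : BimoduleHom M N) : M →ₗ[A] N where
  toFun := f
  map_add' := f.toLinearMap.map_add
  map_smul' := f.map_left

@[simp]
theorem BimoduleHom.lin_apply {M N : Bimodule 𝕜 A} (f : BimoduleHom M N) (x : M) :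
    f.lin x = f x := rfl

variable {M N N' N'' P : Bimodule 𝕜 A}

theorem tens_hom_ext {X : Bimodule 𝕜 A} {f g : tens M N →ₗ[A] X}
    (h : ∀ m n, f (tmul m n) = g (tmul m n)) : f = g := by
  ext x
  induction x using tens_induction with
  | hz => rw [map_zero, map_zero]
  | ht m n => exact h m n
  | ha x y hx hy => rw [map_add, map_add, hx, hy]

theorem tmul_zero_right (m : M) : tmul m (0 : N) = 0 := map_zero (tmulHom M N m)

theorem tmul_zero_left (n : N) : tmul (0 : M) n = 0 := map_zero ((tmulHom M N).flip n)

/-- `id ⊗ f : M ⊗_A N → M ⊗_A N'` for a left `A`-linear map `f`. -/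
def lTens (M : Bimodule 𝕜 A) (f : N →ₗ[A] N') : tens M N →ₗ[A] tens M N' :=
  let g : tens M N →ₗ[𝕜] tens M N' := lift ((tmulHom M N').compl₂ (f.restrictScalars 𝕜))
    (fun a m n => by
      simp only [LinearMap.compl₂_apply, LinearMap.coe_restrictScalars, tmulHom_apply, map_smul,
        tmul_balanced])
  { toFun := g
    map_add' := g.map_add
    map_smul' := fun a x => by
      induction x using tens_induction with
      | hz => simp only [smul_zero, map_zero]
      | ht m n => rfl
      | ha x y hx hy => simp only [smul_add, map_add, hx, hy] }

@[simp]
theorem lTens_tmul (f : N →ₗ[A] N') (m : M) (n : N) : lTens M f (tmul m n) = tmul m (f n) := rfl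

theorem lTens_comp (g : N' →ₗ[A] N'') (f : N →ₗ[A] N') :
    lTens M (g ∘ₗ f) = lTens M g ∘ₗ lTens M f := tens_hom_ext fun _ _ => rfl

theorem lTens_comp_apply (g : N' →ₗ[A] N'') (f : N →ₗ[A] N') (x : tens M N) :
    lTens M g (lTens M f x) = lTens M (g ∘ₗ f) x := by rw [lTens_comp]; rfl

theorem lTens_id : lTens M (LinearMap.id : N →ₗ[A] N) = LinearMap.id :=
  tens_hom_ext fun _ _ => rfl

theorem lTens_add (f g : N →ₗ[A] N') : lTens M (f + g) = lTens M f + lTens M g :=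
  tens_hom_ext fun m n => tmul_add_right m (f n) (g n)

theorem lTens_zero : lTens M (0 : N →ₗ[A] N') = 0 := tens_hom_ext fun m _ => tmul_zero_right m

theorem lTens_neg (f : N →ₗ[A] N') : lTens M (-f) = -lTens M f := by
  rw [eq_neg_iff_add_eq_zero, ← lTens_add, neg_add_cancel, lTens_zero]

theorem tensMap_id_lin (f : BimoduleHom N N') :
    (tensMap (BimoduleHom.id M) f).lin = lTens M f.lin := tens_hom_ext fun _ _ => rfl

theorem tensMap_id_apply (f : BimoduleHom N N') (x : tens M N) :
    tensMap (BimoduleHom.id M) f x = lTens M f.lin x :=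
  LinearMap.congr_fun (tensMap_id_lin f) x

/-- The left linear map `m ↦ m ⊗ n`. -/
def ins (M : Bimodule 𝕜 A) (n : N) : M →ₗ[A] tens M N where
  toFun m := tmul m n
  map_add' m m' := tmul_add_left m m' n
  map_smul' _ _ := rfl

@[simp]
theorem ins_apply (m : M) (n : N) : ins M n m = tmul m n := rfl

theorem lTens_comp_ins (f : N →ₗ[A] N') (n : N) : lTens M f ∘ₗ ins M n = ins M (f n) := rfl

/-- Reassociation becomes id ⊗ (· ⊗ p). This map is only left linear, which is why left linear maps,
and not just bimodule maps, are used throughout: carrying along an inert tail is then an instance of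
naturality. -/
theorem assocR_eq_lTens (t : tens M N) (p : P) : assocR M N P (tmul t p) = lTens M (ins N p) t := by
  have : (assocR M N P).lin ∘ₗ ins (tens M N) p = lTens M (ins N p) := tens_hom_ext fun _ _ => rfl
  exact LinearMap.congr_fun this t

/-! ### Naturality of the wedge product and of the braiding -/

namespace DGA

variable (C : DGA 𝕜 A)

theorem form_one_induction {p : C.form 1 → Prop} (x : C.form 1) (hz : p 0)
    (ht : ∀ (a b : A), p (a • C.d₀ b)) (ha : ∀ x y, p x → p y → p (x + y)) : p x := by
  obtain ⟨x, hx⟩ := x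
  have hx' := hx
  rw [← C.span_one] at hx'
  -- The predicate is only assumed additive, so closure under scalars is built into the induction; a
  -- scalar is absorbed through c (a db) = (c a) db.
  suffices h : ∀ c : 𝕜, ∃ h : c • x ∈ C.gr 1, p ⟨c • x, h⟩ by
    obtain ⟨h, h'⟩ := h 1
    simpa only [one_smul] using h'
  clear hx
  induction hx' using Submodule.span_induction with
  | mem x hx =>
    intro c
    obtain ⟨a, b, rfl⟩ := hx
    have e : c • (C.ι a * C.d (C.ι b)) = C.ι (c • a) * C.d (C.ι b) := by
      rw [map_smul, smul_mul_assoc]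
    rw [e]
    exact ⟨C.ι_mul_mem _ (C.d_mem 0 _ (C.ι_mem b)), ht (c • a) b⟩
  | zero => intro c; rw [smul_zero]; exact ⟨zero_mem _, hz⟩
  | add x y _ _ h1 h2 =>
    intro c
    obtain ⟨h1, h1'⟩ := h1 c
    obtain ⟨h2, h2'⟩ := h2 c
    rw [smul_add]
    exact ⟨add_mem h1 h2, ha _ _ h1' h2'⟩
  | smul c' x _ h => intro c; rw [smul_smul]; exact h _

variable {C} {M N N' X : Bimodule 𝕜 A}

/-- As m ⊗ a db = m a ⊗ db, exact forms suffice in the last factor. Identities read off from right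
Leibniz rules, which only see elements m ⊗ da, thereby hold everywhere. -/
theorem tens_form_one_ext {f g : tens M (C.form 1) →ₗ[A] X}
    (h : ∀ m a, f (tmul m (C.d₀ a)) = g (tmul m (C.d₀ a))) : f = g := by
  refine tens_hom_ext fun m x => ?_
  induction x using C.form_one_induction generalizing m with
  | hz => rw [tmul_zero_right, map_zero, map_zero]
  | ht a b => rw [← tmul_balanced, h]
  | ha x y hx hy => rw [tmul_add_right, map_add, map_add, hx, hy]

theorem tens_tens_ext {M M' : Bimodule 𝕜 A} {f g : tens M (tens M' N) →ₗ[A] X}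
    (h : ∀ m m' n, f (tmul m (tmul m' n)) = g (tmul m (tmul m' n))) : f = g := by
  refine tens_hom_ext fun m x => ?_
  induction x using tens_induction with
  | hz => rw [tmul_zero_right, map_zero, map_zero]
  | ht m' n => exact h m m' n
  | ha x y hx hy => rw [tmul_add_right, map_add, map_add, hx, hy]

theorem tens_tens_tens_ext {M M' M'' : Bimodule 𝕜 A} {f g : tens M (tens M' (tens M'' N)) →ₗ[A] X}
    (h : ∀ m m' m'' n, f (tmul m (tmul m' (tmul m'' n))) = g (tmul m (tmul m' (tmul m'' n)))) :
    f = g := by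
  refine tens_tens_ext fun m m' x => ?_
  induction x using tens_induction with
  | hz => simp only [tmul_zero_right, map_zero]
  | ht m'' n => exact h m m' m'' n
  | ha x y hx hy => simp only [tmul_add_right, map_add, hx, hy]

theorem wedgeFst_tmul (x y : C.form 1) (n : N) :
    C.wedgeFst N (tmul x (tmul y n)) = tmul (C.wedge (tmul x y)) n := rfl

theorem wedgeFst_lTens_lTens (f : N →ₗ[A] N') (t : tens (C.form 1) (tens (C.form 1) N)) :
    C.wedgeFst N' (lTens _ (lTens _ f) t) = lTens _ f (C.wedgeFst N t) := by
  have : (C.wedgeFst N').lin ∘ₗ lTens _ (lTens _ f) = lTens _ f ∘ₗ (C.wedgeFst N).lin :=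
    tens_tens_ext fun _ _ _ => rfl
  exact LinearMap.congr_fun this t

theorem wedgeFst_lTens_ins (t : tens (C.form 1) (C.form 1)) (n : N) :
    C.wedgeFst N (lTens _ (ins _ n) t) = tmul (C.wedge t) n := by
  have : (C.wedgeFst N).lin ∘ₗ lTens _ (ins _ n) = ins _ n ∘ₗ C.wedge.lin :=
    tens_hom_ext fun _ _ => rfl
  exact LinearMap.congr_fun this t

end DGA

namespace BimoduleConnection

open DGA

variable {C : DGA 𝕜 A} (D : BimoduleConnection C) {N N' X : Bimodule 𝕜 A}

theorem braidFst_tmul (x y : C.form 1) (n : N) :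
    D.braidFst N (tmul x (tmul y n)) = lTens _ (ins _ n) (D.σ (tmul x y)) :=
  assocR_eq_lTens _ _

theorem braidFst_lTens_ins (t : tens (C.form 1) (C.form 1)) (n : N) :
    D.braidFst N (lTens _ (ins _ n) t) = lTens _ (ins _ n) (D.σ t) := by
  have : (D.braidFst N).lin ∘ₗ lTens _ (ins _ n) = lTens _ (ins _ n) ∘ₗ D.σ.lin :=
    tens_hom_ext fun _ _ => D.braidFst_tmul _ _ _
  exact LinearMap.congr_fun this t

theorem braidFst_lTens_lTens (f : N →ₗ[A] N') (t : tens (C.form 1) (tens (C.form 1) N)) :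
    D.braidFst N' (lTens _ (lTens _ f) t) = lTens _ (lTens _ f) (D.braidFst N t) := by
  have : (D.braidFst N').lin ∘ₗ lTens _ (lTens _ f) =
      lTens _ (lTens _ f) ∘ₗ (D.braidFst N).lin := tens_tens_ext fun x y n => by
    simp only [LinearMap.comp_apply, lTens_tmul, BimoduleHom.lin_apply, braidFst_tmul,
      lTens_comp_apply, lTens_comp_ins]
  exact LinearMap.congr_fun this t

theorem lTens_braidFst_lTens_lTens_ins (t : tens (C.form 1) (tens (C.form 1) (C.form 1))) (n : N) :
    lTens _ (D.braidFst N).lin (lTens _ (lTens _ (ins _ n)) t) =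
      lTens _ (lTens _ (ins _ n)) (lTens _ D.σ.lin t) := by
  rw [lTens_comp_apply, lTens_comp_apply]
  congr 2
  exact tens_hom_ext fun _ _ => D.braidFst_tmul _ _ _

/-! ### The braid relation, and the compatibility of `∇` with the braiding -/

/-- The right Leibniz rule of ∇₂: its generalised braiding is σ₁σ₂, evaluated here on t ⊗ da. -/
theorem tensConn_apply_op_smul (t : tens (C.form 1) (C.form 1)) (a : A) :
    D.tensConn D.toLeftConnection (op a • t) = op a • D.tensConn D.toLeftConnection t +
      D.braidFst (C.form 1) (lTens _ D.σ.lin (lTens _ (ins _ (C.d₀ a)) t)) := by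
  induction t using tens_induction with
  | hz => simp
  | ht x y =>
    change D.tensConnFun _ (op a • tmul x y) = op a • D.tensConnFun _ (tmul x y) + _
    rw [op_smul_tmul, tensConnFun_tmul, tensConnFun_tmul, D.isBraiding, tmul_add_right, map_add,
      smul_add, ← op_smul_tmul, ← op_smul_tmul, BimoduleHom.map_right, BimoduleHom.map_right,
      add_assoc]
    rfl
  | ha x y hx hy => simp only [smul_add, map_add, hx, hy]; abel

variable {D}

/-- Evaluate ∇₂σ₁ = σ₂∇₂ on u a. The terms (∇₂ ·) a agree, and the remaining ones read σ₁σ₂σ₁ =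
σ₂σ₁σ₂ on u ⊗ da. -/
theorem LeibnizCompatible.braid (h : D.LeibnizCompatible)
    (t : tens (C.form 1) (tens (C.form 1) (C.form 1))) :
    D.braidFst _ (lTens _ D.σ.lin (D.braidFst _ t)) =
      lTens _ D.σ.lin (D.braidFst _ (lTens _ D.σ.lin t)) := by
  have key : ∀ (u : tens (C.form 1) (C.form 1)) (a : A),
      D.braidFst _ (lTens _ D.σ.lin (lTens _ (ins _ (C.d₀ a)) (D.σ u))) =
      lTens _ D.σ.lin (D.braidFst _ (lTens _ D.σ.lin (lTens _ (ins _ (C.d₀ a)) u))) := by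
    intro u a
    have h1 := h (op a • u)
    rw [D.σ.map_right, tensConn_apply_op_smul, tensConn_apply_op_smul, h u, map_add,
      BimoduleHom.map_right] at h1
    rw [tensMap_id_apply] at h1
    exact add_left_cancel h1
  have : (D.braidFst _).lin ∘ₗ lTens _ D.σ.lin ∘ₗ (D.braidFst _).lin =
      lTens _ D.σ.lin ∘ₗ (D.braidFst _).lin ∘ₗ lTens _ D.σ.lin := by
    have h2 : ∀ (x y : C.form 1), ((D.braidFst _).lin ∘ₗ lTens _ D.σ.lin ∘ₗ (D.braidFst _).lin) ∘ₗ
      ((assocR _ _ _).lin) = (lTens _ D.σ.lin ∘ₗ (D.braidFst _).lin ∘ₗ lTens _ D.σ.lin) ∘ₗ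
       ((assocR _ _ _).lin) := by
      intro x y
      refine tens_form_one_ext fun u a => ?_
      simp only [LinearMap.comp_apply, BimoduleHom.lin_apply, assocR_eq_lTens, braidFst_lTens_ins]
      exact key u a
    refine tens_tens_ext fun x y z => ?_
    exact LinearMap.congr_fun (h2 x y) (tmul (tmul x y) z)
  exact LinearMap.congr_fun this t

theorem LeibnizCompatible.braidFst_braid (h : D.LeibnizCompatible)
    (t : tens (C.form 1) (tens (C.form 1) (tens (C.form 1) N))) :
    D.braidFst _ (lTens _ (D.braidFst N).lin (D.braidFst _ t)) =
      lTens _ (D.braidFst N).lin (D.braidFst _ (lTens _ (D.braidFst N).lin t)) := by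
  have : (D.braidFst _).lin ∘ₗ lTens _ (D.braidFst N).lin ∘ₗ (D.braidFst _).lin =
      lTens _ (D.braidFst N).lin ∘ₗ (D.braidFst _).lin ∘ₗ lTens _ (D.braidFst N).lin := by
    refine tens_tens_tens_ext fun x y z n => ?_
    change D.braidFst _ (lTens _ (D.braidFst N).lin (D.braidFst _
        (lTens _ (lTens _ (ins _ n)) (tmul x (tmul y z))))) = lTens _ (D.braidFst N).lin
      (D.braidFst _ (lTens _ (D.braidFst N).lin (lTens _ (lTens _ (ins _ n)) (tmul x (tmul y z)))))
    simp only [braidFst_lTens_lTens, lTens_braidFst_lTens_lTens_ins, h.braid]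
  exact LinearMap.congr_fun this t

variable (D) in
/-- The right Leibniz rule of a tensor product connection, on `t ⊗ n`. -/
theorem tensConn_tensConn_lTens_ins (E : LeftConnection C N) (t : tens (C.form 1) (C.form 1))
    (n : N) : D.tensConn (D.tensConn E) (lTens _ (ins _ n) t) =
      lTens _ (lTens _ (ins _ n)) (D.tensConn D.toLeftConnection t) +
        D.braidFst _ (lTens _ (D.braidFst N).lin (lTens _ (ins _ (E n)) t)) := by
  induction t using tens_induction with
  | hz => simp
  | ht x y =>
    change D.tensConnFun _ (tmul x (tmul y n)) =
      lTens _ (lTens _ (ins _ n)) (D.tensConnFun _ (tmul x y)) + _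
    rw [tensConnFun_tmul, tensConnFun_tmul]
    change _ + D.braidFst _ (tmul x (D.tensConnFun E (tmul y n))) = _
    rw [tensConnFun_tmul, tmul_add_right, map_add, map_add, assocR_eq_lTens, assocR_eq_lTens,
      assocR_eq_lTens, lTens_comp_apply, ← lTens_tmul, braidFst_lTens_lTens, add_assoc]
    rfl
  | ha x y hx hy => simp only [map_add, hx, hy]; abel

/-- In ∇(t ⊗ n) = ∇₂t ⊗ n + σ₁σ₂(t ⊗ ∇n), replacing t by σt produces σ₂ in front: for the first term
by Leibniz compatibility, for the second by the braid relation. -/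
theorem LeibnizCompatible.tensConn_tensConn_braidFst (h : D.LeibnizCompatible)
    (E : LeftConnection C N) (t : tens (C.form 1) (tens (C.form 1) N)) :
    D.tensConn (D.tensConn E) (D.braidFst N t) =
      lTens _ (D.braidFst N).lin (D.tensConn (D.tensConn E) t) := by
  induction t using tens_induction with
  | hz => simp
  | ha x y hx hy => simp only [map_add, hx, hy]
  | ht x t =>
    induction t using tens_induction with
    | hz => simp [tmul_zero_right]
    | ha t u ht hu => simp only [tmul_add_right, map_add, ht, hu]
    | ht y n =>
      rw [braidFst_tmul, tensConn_tensConn_lTens_ins]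
      change _ = lTens _ (D.braidFst N).lin (D.tensConn (D.tensConn E)
        (lTens _ (ins _ n) (tmul x y)))
      rw [tensConn_tensConn_lTens_ins, map_add, lTens_braidFst_lTens_lTens_ins, h,
        tensMap_id_apply, ← h.braidFst_braid, braidFst_lTens_ins]

/-! ### Consequences of torsion freeness, extendability and `∧`-compatibility -/

/-- Compare ∧∇(x a), computed with the right Leibniz rule of ∇, with d(x a) = (dx) a - x ∧ da. -/
theorem TorsionFree.wedge_σ (h : D.TorsionFree) (t : tens (C.form 1) (C.form 1)) :
    C.wedge (D.σ t) = -C.wedge t := by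
  have : C.wedge.lin ∘ₗ D.σ.lin = -C.wedge.lin := by
    refine tens_form_one_ext fun x a => ?_
    have h1 := h (op a • x)
    rw [nabla, D.isBraiding, map_add, BimoduleHom.map_right, C.d₁_op_smul, ← h x,
      sub_eq_add_neg] at h1
    exact add_left_cancel h1
  exact LinearMap.congr_fun this t

theorem TorsionFree.wedgeFst_braidFst (h : D.TorsionFree)
    (t : tens (C.form 1) (tens (C.form 1) N)) :
    C.wedgeFst N (D.braidFst N t) = -C.wedgeFst N t := by
  have : (C.wedgeFst N).lin ∘ₗ (D.braidFst N).lin = -(C.wedgeFst N).lin := by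
    refine tens_tens_ext fun x y n => ?_
    change C.wedgeFst N (D.braidFst N (tmul x (tmul y n))) = -C.wedgeFst N (tmul x (tmul y n))
    rw [braidFst_tmul, wedgeFst_lTens_ins, h.wedge_σ, wedgeFst_tmul]
    exact map_neg (ins _ n) _
  exact LinearMap.congr_fun this t

/-- Torsion freeness gives ∧∇x = dx, and ∧σ = -∧ supplies the sign in d ⊗ id - id ∧ ∇. So the
curvature of E is ∧₁ applied to two successive derivatives. -/
theorem TorsionFree.wedgeFst_tensConn (h : D.TorsionFree) (E : LeftConnection C N)
    (t : tens (C.form 1) N) : C.wedgeFst N (D.tensConn E t) = E.covExt t := by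
  induction t using tens_induction with
  | hz => simp
  | ha x y hx hy => simp only [map_add, hx, hy]
  | ht x n =>
    change C.wedgeFst N (D.tensConnFun E (tmul x n)) = tmul (C.d₁ x) n - C.wedgeFst N (tmul x (E n))
    rw [tensConnFun_tmul, map_add, h.wedgeFst_braidFst, assocR_eq_lTens, wedgeFst_lTens_ins, h x,
      sub_eq_add_neg]

/-- Extendability with an inert tail N: ∧₁σ₂σ₁ factors through ∧₂. Only the existence of a left
linear factor matters later. -/
theorem Extendable.exists_braid (h : D.Extendable) (N : Bimodule 𝕜 A) :
    ∃ τ : tens (C.form 1) (tens (C.form 2) N) →ₗ[A] tens (C.form 2) (tens (C.form 1) N),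
      ∀ t, C.wedgeFst _ (lTens _ (D.braidFst N).lin (D.braidFst _ t)) =
        τ (lTens _ (C.wedgeFst N).lin t) := by
  obtain ⟨τ, hτ⟩ := h
  refine ⟨((assocR _ _ _).comp ((tensMap τ (BimoduleHom.id N)).comp (assocL _ _ _))).lin,
    fun t => ?_⟩
  have : (C.wedgeFst _).lin ∘ₗ lTens _ (D.braidFst N).lin ∘ₗ (D.braidFst _).lin =
    ((assocR _ _ _).comp ((tensMap τ (BimoduleHom.id N)).comp (assocL _ _ _))).lin ∘ₗ
      lTens _ (C.wedgeFst N).lin := by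
    refine tens_tens_tens_ext fun x y z n => ?_
    change C.wedgeFst _ (lTens _ (D.braidFst N).lin (D.braidFst _
      (lTens _ (lTens _ (ins _ n)) (tmul x (tmul y z))))) =
        assocR _ _ _ (tmul (τ (tmul x (C.wedge (tmul y z)))) n)
    rw [hτ, braidFst_lTens_lTens, lTens_braidFst_lTens_lTens_ins, wedgeFst_lTens_lTens,
      assocR_eq_lTens, tensMap_id_apply]
  exact LinearMap.congr_fun this t

end BimoduleConnection

/-! ### Tensor products with a bimodule connection, and descent of ∇ along ∧ -/

namespace LeftConnection

variable {C : DGA 𝕜 A} {M N : Bimodule 𝕜 A}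

/-- The braiding of `M` and `Ω¹`, applied to the first two factors of `M ⊗ Ω¹ ⊗ N`. -/
def tensBraid (τ : BimoduleHom (tens M (C.form 1)) (tens (C.form 1) M)) (N : Bimodule 𝕜 A) :
    BimoduleHom (tens M (tens (C.form 1) N)) (tens (C.form 1) (tens M N)) :=
  (assocR _ _ _).comp ((tensMap τ (BimoduleHom.id N)).comp (assocL _ _ _))

theorem tensBraid_tmul (τ : BimoduleHom (tens M (C.form 1)) (tens (C.form 1) M))
    (m : M) (x : C.form 1) (n : N) :
    tensBraid τ N (tmul m (tmul x n)) = lTens _ (ins _ n) (τ (tmul m x)) :=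
  assocR_eq_lTens _ _

/-- The tensor product of a bimodule connection on `M` and a left connection on `N`, as a map. -/
def tensorFun (E : LeftConnection C M) {τ : BimoduleHom (tens M (C.form 1)) (tens (C.form 1) M)}
    (hτ : E.IsBraiding τ) (E' : LeftConnection C N) :
    tens M N →ₗ[𝕜] tens (C.form 1) (tens M N) :=
  lift (LinearMap.mk₂ 𝕜
      (fun (x : M) (n : N) =>
        assocR (C.form 1) M N (tmul (E x) n) + tensBraid τ N (tmul x (E' n)))
      (fun x y n => by simp only [tmul_add_left, map_add]; abel)
      (fun c x n => by simp only [tmul_smul_left, map_smul, smul_add])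
      (fun x m n => by simp only [tmul_add_right, map_add]; abel)
      (fun c x n => by simp only [tmul_smul_right, map_smul, smul_add]))
    (fun a x n => by
      simp only [LinearMap.mk₂_apply]
      have h : tensBraid τ N (tmul x (tmul (C.d₀ a) n)) =
        assocR (C.form 1) M N (tmul (τ (tmul x (C.d₀ a))) n) := rfl
      rw [hτ, tmul_add_left, map_add, E'.leibniz, tmul_add_right, map_add, h,
        tmul_balanced, tmul_balanced]
      abel)

theorem tensorFun_tmul (E : LeftConnection C M)
    {τ : BimoduleHom (tens M (C.form 1)) (tens (C.form 1) M)}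
    (hτ : E.IsBraiding τ) (E' : LeftConnection C N) (x : M) (n : N) :
    tensorFun E hτ E' (tmul x n) =
      lTens _ (ins _ n) (E x) + tensBraid τ N (tmul x (E' n)) := by
  rw [← assocR_eq_lTens]; rfl

/-- The tensor product of a bimodule connection on `M` and a left connection on `N`. -/
def tensor (E : LeftConnection C M) {τ : BimoduleHom (tens M (C.form 1)) (tens (C.form 1) M)}
    (hτ : E.IsBraiding τ) (E' : LeftConnection C N) : LeftConnection C (tens M N) where
  toLinearMap := tensorFun E hτ E'
  leibniz a t := by
    induction t using tens_induction with
    | hz =>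
      rw [smul_zero, map_zero, smul_zero, add_zero, tmul_zero_right]
    | ht x n =>
      rw [smul_tmul, tensorFun_tmul, tensorFun_tmul, E.leibniz, map_add, smul_add, lTens_tmul,
        ins_apply, map_smul, ← smul_tmul, BimoduleHom.map_left, add_assoc]
    | ha x y hx hy =>
      rw [smul_add, map_add, map_add, hx, hy, tmul_add_right, smul_add]
      abel

end LeftConnection

namespace BimoduleConnection

open DGA LeftConnection

variable {C : DGA 𝕜 A} {D : BimoduleConnection C} {N : Bimodule 𝕜 A}

/-- The braiding of the connection on Ω² is forced: the right Leibniz rules of the two sides of E ∧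
= ∧₂∇₂, evaluated on u a, give τ(∧u ⊗ da) = ∧₂σ₁σ₂(u ⊗ da). -/
theorem wedge_braid_of_isBraiding {E : LeftConnection C (C.form 2)}
    {τ : BimoduleHom (tens (C.form 2) (C.form 1)) (tens (C.form 1) (C.form 2))}
    (hτ : E.IsBraiding τ) (hE : ∀ u : tens (C.form 1) (C.form 1),
      E (C.wedge u) = lTens _ C.wedge.lin (D.tensConn D.toLeftConnection u))
    (t : tens (C.form 1) (tens (C.form 1) (tens (C.form 1) N))) :
    lTens _ (C.wedgeFst N).lin (D.braidFst _ (lTens _ (D.braidFst N).lin t)) =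
      tensBraid τ N (C.wedgeFst _ t) := by
  have key : (lTens _ C.wedge.lin ∘ₗ (D.braidFst _).lin ∘ₗ lTens _ D.σ.lin) ∘ₗ (assocR _ _ _).lin =
      τ.lin ∘ₗ (tensMap C.wedge (BimoduleHom.id _)).lin := by
    refine tens_form_one_ext fun u a => ?_
    have h1 := hE (op a • u)
    rw [C.wedge.map_right, hτ, hE, tensConn_apply_op_smul, map_add] at h1
    have h2 : lTens _ C.wedge.lin (op a • D.tensConn D.toLeftConnection u) =
        op a • lTens _ C.wedge.lin (D.tensConn D.toLeftConnection u) := by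
      rw [← tensMap_id_apply, BimoduleHom.map_right, tensMap_id_apply]
    rw [h2] at h1
    have h3 := add_left_cancel h1
    simp only [LinearMap.comp_apply, BimoduleHom.lin_apply, assocR_eq_lTens]
    exact h3.symm
  have : lTens _ (C.wedgeFst N).lin ∘ₗ (D.braidFst _).lin ∘ₗ lTens _ (D.braidFst N).lin =
      (tensBraid τ N).lin ∘ₗ (C.wedgeFst _).lin := by
    refine tens_tens_tens_ext fun x y z n => ?_
    change lTens _ (C.wedgeFst N).lin (D.braidFst _ (lTens _ (D.braidFst N).lin
      (lTens _ (lTens _ (ins _ n)) (tmul x (tmul y z))))) =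
        tensBraid τ N (tmul (C.wedge (tmul x y)) (tmul z n))
    rw [lTens_braidFst_lTens_lTens_ins, braidFst_lTens_lTens, tensBraid_tmul]
    have h2 := LinearMap.congr_fun key (tmul (tmul x y) z)
    change lTens _ C.wedge.lin (D.braidFst _ (lTens _ D.σ.lin (tmul x (tmul y z)))) =
      τ (tmul (C.wedge (tmul x y)) z) at h2
    rw [← h2, lTens_comp_apply, lTens_comp_apply]
    congr 2
    exact tens_hom_ext fun _ _ => rfl
  exact LinearMap.congr_fun this t

theorem WedgeCompatible.exists_isBraiding (h : D.WedgeCompatible) :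
    ∃ (E : LeftConnection C (C.form 2))
      (τ : BimoduleHom (tens (C.form 2) (C.form 1)) (tens (C.form 1) (C.form 2))),
      E.IsBraiding τ ∧ ∀ u : tens (C.form 1) (C.form 1),
        E (C.wedge u) = lTens _ C.wedge.lin (D.tensConn D.toLeftConnection u) := by
  obtain ⟨E, τ, hτ, hE⟩ := h
  refine ⟨E, τ, hτ, fun u => ?_⟩
  induction u using tens_induction with
  | hz => simp
  | ha x y hx hy => simp only [map_add, hx, hy]
  | ht x y => rw [hE, tensMap_id_apply]; rfl

theorem WedgeCompatible.exists_braid (h : D.WedgeCompatible) (N : Bimodule 𝕜 A) :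
    ∃ τ : tens (C.form 2) (tens (C.form 1) N) →ₗ[A] tens (C.form 1) (tens (C.form 2) N),
      ∀ t, lTens _ (C.wedgeFst N).lin (D.braidFst _ (lTens _ (D.braidFst N).lin t)) =
        τ (C.wedgeFst _ t) := by
  obtain ⟨E, τ, hτ, hE⟩ := h.exists_isBraiding
  exact ⟨(tensBraid τ N).lin, wedge_braid_of_isBraiding hτ hE⟩

/-- `∇` on `Ω¹ ⊗ Ω¹ ⊗ N` descends along `∧` to a connection on `Ω² ⊗ N`. -/
theorem WedgeCompatible.exists_connection (h : D.WedgeCompatible) (E : LeftConnection C N) :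
    ∃ E' : LeftConnection C (tens (C.form 2) N), ∀ t,
      E' (C.wedgeFst N t) = lTens _ (C.wedgeFst N).lin (D.tensConn (D.tensConn E) t) := by
  obtain ⟨F, τ, hτ, hF⟩ := h.exists_isBraiding
  -- F is the connection on Ω² supplied by ∧-compatibility. Its tensor product with E is defined
  -- because F has the braiding τ.
  refine ⟨F.tensor hτ E, fun t => ?_⟩
  induction t using tens_induction with
  | hz => simp
  | ha x y hx hy => simp only [map_add, hx, hy]
  | ht x t =>
    induction t using tens_induction with
    | hz => simp [tmul_zero_right]
    | ha t u ht hu => simp only [tmul_add_right, map_add, ht, hu]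
    | ht y n =>
      change F.tensorFun hτ E (tmul (C.wedge (tmul x y)) n) = lTens _ (C.wedgeFst N).lin
        (D.tensConn (D.tensConn E) (lTens _ (ins _ n) (tmul x y)))
      rw [tensConn_tensConn_lTens_ins, tensorFun_tmul, hF, map_add,
        wedge_braid_of_isBraiding hτ hF, wedgeFst_lTens_ins, lTens_comp_apply, lTens_comp_apply]
      congr 3
      exact (tens_hom_ext fun _ _ => rfl)

/-! ### Flatness of the tensor product connections -/

-- Expanding id ∧ ∇ on t ⊗ n differentiates either the second letter of t or n. In the latter case
-- σ₂ first brings the new form next to the first letter.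
variable (D) in
theorem covExt_tensConn_lTens_ins (E : LeftConnection C N) (t : tens (C.form 1) (C.form 1))
    (n : N) : (D.tensConn E).covExt (lTens _ (ins _ n) t) =
      lTens _ (ins _ n) (D.toLeftConnection.covExt t) -
        C.wedgeFst _ (lTens _ (D.braidFst N).lin (lTens _ (ins _ (E n)) t)) := by
  induction t using tens_induction with
  | hz => simp
  | ha x y hx hy => simp only [map_add, hx, hy]; abel
  | ht x y =>
    change tmul (C.d₁ x) (tmul y n) - C.wedgeFst _ (tmul x (D.tensConnFun E (tmul y n))) =
      lTens _ (ins _ n) (tmul (C.d₁ x) y - C.wedgeFst _ (tmul x (D.nabla y))) - _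
    rw [tensConnFun_tmul, tmul_add_right, map_add, map_sub, sub_sub, assocR_eq_lTens,
      ← wedgeFst_lTens_lTens]
    rfl

/-- For w = y ⊗ m, torsion freeness rewrites the exterior derivative of σ(x ⊗ y) as ∧₁∇₂σ, Leibniz
compatibility as ∧₁σ₂∇₂. Extendability turns the part ∧₁σ₂σ₁(x ⊗ ∇y) into τ(x ⊗ dy), and likewise
the term containing ∇m into τ(x ⊗ y ∧ ∇m). Together these form τ applied to x and the exterior
derivative of w. -/
theorem covExt_tensConn_braidFst (torsionFree : D.TorsionFree)
    (leibniz : D.LeibnizCompatible)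
    {τ : BimoduleHom (tens (C.form 1) (C.form 2)) (tens (C.form 2) (C.form 1))}
    (hτ : ∀ ω η ζ : C.form 1, τ (tmul ω (C.wedge (tmul η ζ))) =
      C.wedgeFst _ (tensMap (BimoduleHom.id _) D.σ (D.braidFst _ (tmul ω (tmul η ζ)))))
    (E : LeftConnection C N) (x : C.form 1) (w : tens (C.form 1) N) :
    (D.tensConn E).covExt (D.braidFst N (tmul x w)) =
      C.wedgeFst _ (lTens _ (D.braidFst N).lin (lTens _ (ins _ w) (D.nabla x))) +
        assocR _ _ _ (tensMap τ (BimoduleHom.id N) (assocL _ _ _ (tmul x (E.covExt w)))) := by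
  have hτ' : ∀ (y : C.form 1) (u : tens (C.form 1) (C.form 1)), τ (tmul y (C.wedge u)) =
      C.wedgeFst _ (lTens _ D.σ.lin (D.braidFst _ (tmul y u))) := by
    intro y u
    induction u using tens_induction with
    | hz => simp [tmul_zero_right]
    | ha t u ht hu => simp only [tmul_add_right, map_add, ht, hu]
    | ht z v => rw [hτ, tensMap_id_apply]
  have hτN : ∀ (y : C.form 1) (u : tens (C.form 1) (tens (C.form 1) N)),
      assocR _ _ _ (tensMap τ (BimoduleHom.id N) (assocL _ _ _ (tmul y (C.wedgeFst N u)))) =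
      C.wedgeFst _ (lTens _ (D.braidFst N).lin (D.braidFst _ (tmul y u))) := by
    intro y u
    induction u using tens_induction with
    | hz => simp [tmul_zero_right]
    | ha t u ht hu => simp only [tmul_add_right, map_add, ht, hu]
    | ht z v =>
      induction v using tens_induction with
      | hz => simp [tmul_zero_right]
      | ha t u ht hu => simp only [tmul_add_right, map_add, ht, hu]
      | ht v n =>
        change assocR _ _ _ (tmul (τ (tmul y (C.wedge (tmul z v)))) n) =
          C.wedgeFst _ (lTens _ (D.braidFst N).lin
            (D.braidFst _ (lTens _ (lTens _ (ins _ n)) (tmul y (tmul z v)))))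
        rw [hτ', braidFst_lTens_lTens, lTens_braidFst_lTens_lTens_ins, wedgeFst_lTens_lTens,
          assocR_eq_lTens]
  induction w using tens_induction with
  | hz =>
    have h0 : ins (C.form 1) (0 : tens (C.form 1) N) = 0 := by
      ext m
      exact tmul_zero_right m
    simp only [h0, lTens_zero, map_zero, tmul_zero_right, LinearMap.zero_apply, add_zero]
  | ha u v hu hv =>
    have h0 : ins (C.form 1) (u + v) = ins _ u + ins _ v := by
      ext m
      exact tmul_add_right m u v
    simp only [h0, lTens_add, map_add, tmul_add_right, LinearMap.add_apply, hu, hv]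
    abel
  | ht y m =>
    have hc : E.covExt (tmul y m) = tmul (C.d₁ y) m - C.wedgeFst _ (tmul y (E m)) := rfl
    rw [braidFst_tmul, covExt_tensConn_lTens_ins, ← torsionFree.wedgeFst_tensConn, leibniz, hc]
    have h1 : D.tensConn D.toLeftConnection (tmul x y) =
        lTens _ (ins _ y) (D.nabla x) + D.braidFst _ (tmul x (D.nabla y)) := by
      rw [← assocR_eq_lTens]; rfl
    have h2 : tmul x (tmul (C.d₁ y) m - C.wedgeFst _ (tmul y (E m))) =
        tmul x (tmul (C.d₁ y) m) - tmul x (C.wedgeFst _ (tmul y (E m))) :=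
      map_sub (tmulHom _ _ x) _ _
    have h3 : assocR _ _ _ (tensMap τ (BimoduleHom.id N) (assocL _ _ _
        (tmul x (tmul (C.d₁ y) m)))) = lTens _ (ins _ m) (τ (tmul x (C.d₁ y))) :=
      assocR_eq_lTens _ _
    have h4 : lTens _ (D.braidFst N).lin (lTens _ (ins _ (tmul y m)) (D.nabla x)) =
        lTens _ (lTens _ (ins _ m)) (lTens _ D.σ.lin (lTens _ (ins _ y) (D.nabla x))) := by
      rw [← lTens_braidFst_lTens_lTens_ins, lTens_comp_apply (lTens _ (ins _ m)), lTens_comp_ins]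
      rfl
    rw [tensMap_id_apply, h1, map_add, map_add, map_add, ← hτ', torsionFree y, h2, map_sub,
      map_sub, map_sub, h3, hτN, h4, wedgeFst_lTens_lTens, ← braidFst_lTens_ins, lTens_tmul,
      ins_apply]
    abel

/-- The exterior derivatives of ∇x ⊗ n and of σ₁(x ⊗ ∇n) contain ∧₁σ₂(∇x ⊗ ∇n) with opposite signs.
What survives is R(x) ⊗ n and τ(x ⊗ R(n)), both zero. -/
theorem curvature_tensConn (torsionFree : D.TorsionFree) (flat : D.Flat)
    (extendable : D.Extendable) (leibniz : D.LeibnizCompatible) {E : LeftConnection C N}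
    (hE : E.curvature = 0) : (D.tensConn E).curvature = 0 := by
  obtain ⟨τ, hτ⟩ := extendable
  ext t
  induction t using tens_induction with
  | hz => simp
  | ha x y hx hy => simp only [map_add, hx, hy]
  | ht x n =>
    change (D.tensConn E).covExt (D.tensConnFun E (tmul x n)) = 0
    have h1 : D.toLeftConnection.covExt (D.nabla x) = 0 := LinearMap.congr_fun flat x
    have h2 : E.covExt (E n) = 0 := LinearMap.congr_fun hE n
    rw [tensConnFun_tmul, map_add, assocR_eq_lTens, covExt_tensConn_lTens_ins,
      covExt_tensConn_braidFst torsionFree leibniz hτ, h1, h2]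
    simp [tmul_zero_right]

theorem curvature_connAt (torsionFree : D.TorsionFree) (flat : D.Flat)
    (extendable : D.Extendable) (leibniz : D.LeibnizCompatible) (n : ℕ) :
    (D.connAt n).curvature = 0 := by
  induction n with
  | zero =>
    -- On A the connection is a ↦ da ⊗ 1, so flatness needs d1 = 0 besides d² = 0.
    have h1 : C.d₀ 1 = 0 := by simpa using C.d₀_mul 1 1
    ext (a : A)
    change tmul (C.d₁ (C.d₀ a)) (regularOne 𝕜 A) -
      C.wedgeFst _ (tmul (C.d₀ a) (tmul (C.d₀ 1) (regularOne 𝕜 A))) = 0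
    rw [h1, tmul_zero_left, tmul_zero_right, map_zero, sub_zero]
    have h2 : C.d₁ (C.d₀ a) = 0 := Subtype.ext (C.d_d (C.ι a))
    rw [h2, tmul_zero_left]
  | succ n ih => exact curvature_tensConn torsionFree flat extendable leibniz ih

/-! ### Quantum symmetry of the higher derivatives -/

/-- `∇_n` descends to the target of each `∧_i`. -/
theorem WedgeCompatible.exists_connection_W (h : D.WedgeCompatible) : ∀ i n : ℕ, i + 1 < n →
    ∃ E : LeftConnection C (C.W i n), ∀ t,
      E (C.wedgeAt i n t) = lTens _ (C.wedgeAt i n).lin (D.connAt n t)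
  | 0, n + 2, _ => h.exists_connection (D.connAt n)
  | i + 1, n + 1, hi => by
    obtain ⟨E, hE⟩ := h.exists_connection_W i n (by omega)
    refine ⟨D.tensConn E, fun t => ?_⟩
    induction t using tens_induction with
    | hz => simp
    | ha x y hx hy => simp only [map_add, hx, hy]
    | ht x y =>
      change D.tensConnFun E (tmul x (C.wedgeAt i n y)) =
        lTens _ (tensMap (BimoduleHom.id _) (C.wedgeAt i n)).lin (D.tensConnFun _ (tmul x y))
      rw [tensConnFun_tmul, tensConnFun_tmul, hE, map_add, assocR_eq_lTens, assocR_eq_lTens,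
        tensMap_id_lin, ← braidFst_lTens_lTens, lTens_comp_apply, lTens_comp_ins]
      rfl

theorem mem_quantumSymmetric {n : ℕ} {x : C.T n} :
    x ∈ C.quantumSymmetric n ↔ ∀ i, i + 1 < n → C.wedgeAt i n x = 0 := by
  simp [DGA.quantumSymmetric]

/-- ∧ on the first two factors of ∇∇(·) is the curvature of a tensor power. For any later pair, ∇_n
descends through ∧, so the claim reduces to the symmetry of the previous derivative. -/
theorem nablaPow_mem_quantumSymmetric (torsionFree : D.TorsionFree) (flat : D.Flat)
    (wedgeCompatible : D.WedgeCompatible) (extendable : D.Extendable)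
    (leibniz : D.LeibnizCompatible) (s : A) (n : ℕ) :
    D.nablaPow n s ∈ C.quantumSymmetric n := by
  induction n with
  | zero => exact mem_quantumSymmetric.2 fun i hi => by omega
  | succ n ih =>
    rw [mem_quantumSymmetric] at ih ⊢
    intro i hi
    rcases i with _ | i
    · obtain ⟨n, rfl⟩ := Nat.exists_eq_add_of_le' (show 1 ≤ n by omega)
      change C.wedgeFst _ (D.tensConn (D.connAt n) (D.connAt n (D.nablaPow n s))) = 0
      rw [torsionFree.wedgeFst_tensConn]
      exact LinearMap.congr_fun (curvature_connAt torsionFree flat extendable leibniz n) _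
    · obtain ⟨E, hE⟩ := wedgeCompatible.exists_connection_W i n (by omega)
      have h1 := hE (D.nablaPow n s)
      rw [ih i (by omega), map_zero] at h1
      change tensMap (BimoduleHom.id _) (C.wedgeAt i n) (D.connAt n (D.nablaPow n s)) = 0
      rw [tensMap_id_apply, ← h1]

end BimoduleConnection

/-! ### The ring of operators on the tensor powers -/

/-- Families of left linear operators on the tensor powers of `Ω¹`. -/
abbrev DGA.Ops (C : DGA 𝕜 A) : Type u := ∀ n, Module.End A (C.T n)

namespace DGA

variable (C : DGA 𝕜 A)

/-- The shift `x ↦ id ⊗ x` of operators by one tensor factor; the component in degree `0` is kept,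
so that this is a ring homomorphism. -/
def shiftFun (x : C.Ops) : C.Ops
  | 0 => x 0
  | n + 1 => lTens (C.form 1) (x n)

/-- `DGA.shiftFun` as a ring homomorphism. -/
def shift : C.Ops →+* C.Ops where
  toFun := C.shiftFun
  map_one' := funext fun n => by
    cases n with
    | zero => rfl
    | succ n => exact lTens_id
  map_mul' x y := funext fun n => by
    cases n with
    | zero => rfl
    | succ n => exact lTens_comp _ _
  map_zero' := funext fun n => by
    cases n with
    | zero => rfl
    | succ n => exact lTens_zero
  map_add' x y := funext fun n => by
    cases n with
    | zero => rfl
    | succ n => exact lTens_add _ _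

theorem wedgeAt_succ_lin (i n : ℕ) :
    (C.wedgeAt (i + 1) (n + 1)).lin = lTens (C.form 1) (C.wedgeAt i n).lin := tensMap_id_lin _

/-- Out of range ∧ is the zero map. Factorisations through ∧_r below therefore need no bound on r.
-/
theorem wedgeAt_of_le : ∀ i n : ℕ, n ≤ i + 1 → (C.wedgeAt i n).lin = 0
  | 0, 0, _ => rfl
  | 0, 1, _ => rfl
  | 0, n + 2, h => by omega
  | i + 1, 0, _ => rfl
  | i + 1, n + 1, h => by rw [wedgeAt_succ_lin, wedgeAt_of_le i n (by omega), lTens_zero]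

end DGA

namespace BimoduleConnection

open DGA

variable {C : DGA 𝕜 A} (D : BimoduleConnection C)

/-- `σ` on the first two factors, on all tensor powers. -/
def braidOp : C.Ops
  | 0 => 0
  | 1 => 0
  | n + 2 => (D.braidFst (C.T n)).lin

/-- `σ₁ ⋯ σ_p` on all tensor powers. -/
abbrev runOp (p : ℕ) : C.Ops := run C.shift D.braidOp p

/-- The braided shuffles on all tensor powers. -/
abbrev shufOp (p q : ℕ) : C.Ops := shuf C.shift D.braidOp p q

theorem braidOp_mul_shift_shift (x : C.Ops) :
    D.braidOp * C.shift (C.shift x) = C.shift (C.shift x) * D.braidOp := by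
  funext n
  rcases n with _ | _ | n
  · exact (zero_mul _).trans (mul_zero _).symm
  · exact (zero_mul _).trans (mul_zero _).symm
  · exact LinearMap.ext fun t => D.braidFst_lTens_lTens (x n) t

variable {D} in
theorem LeibnizCompatible.braidOp_braid (h : D.LeibnizCompatible) :
    D.braidOp * C.shift D.braidOp * D.braidOp =
      C.shift D.braidOp * D.braidOp * C.shift D.braidOp := by
  funext n
  rcases n with _ | _ | _ | n
  · exact (mul_zero (M₀ := Module.End A (C.T 0)) _).trans (mul_zero _).symm
  · exact (mul_zero (M₀ := Module.End A (C.T 1)) _).trans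
      ((congrArg (· * _) (mul_zero (M₀ := Module.End A (C.T 1)) _)).trans (zero_mul _)).symm
  -- The value zero of `braidOp` in degree one matters here: it makes σ₂ vanish on two letters. With
  -- the identity instead, the relation would force σ² = σ.
  · have h0 : C.shift D.braidOp 2 = 0 := lTens_zero
    change _ * C.shift D.braidOp 2 * _ = _ * _ * C.shift D.braidOp 2
    rw [h0, mul_zero, zero_mul, mul_zero]
  · exact LinearMap.ext fun t => h.braidFst_braid t

/-! ### Braided binomials as shuffle operators -/

theorem braidRun_succ_succ (n m : ℕ) : (D.braidRun (n + 1) (m + 1)).lin =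
    (D.braidAt 0 (n + 1)).lin ∘ₗ lTens _ (D.braidRun n m).lin := by
  induction m with
  | zero =>
    have e : lTens (C.form 1) (D.braidRun n 0).lin = LinearMap.id := lTens_id
    rw [e]
    rfl
  | succ m ih =>
    change (D.braidRun (n + 1) (m + 1)).lin ∘ₗ (tensMap (BimoduleHom.id _) (D.braidAt m n)).lin = _
    rw [ih, LinearMap.comp_assoc, tensMap_id_lin, ← lTens_comp]
    rfl

/-- `braidRun` grows at its right end and `run` at its left end. The bound m < n is needed since out
of range `braidAt` is the identity and `braidOp` is zero. -/
theorem braidRun_lin (m : ℕ) : ∀ n, m < n → (D.braidRun n m).lin = D.runOp m n := by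
  induction m with
  | zero => exact fun n _ => rfl
  | succ m ih =>
    intro n h
    obtain ⟨n, rfl⟩ := Nat.exists_eq_add_of_le' (show 2 ≤ n by omega)
    rw [braidRun_succ_succ, ih _ (by omega)]
    rfl

/-- The index k of [n; k] is the length of the second block. The shuffle acts in every degree, but
is compared with the binomial only in the degree equal to the total number of letters. -/
theorem binom_lin (n : ℕ) : ∀ p k, k + p = n → (D.binom n k).lin = D.shufOp p k n := by
  induction n with
  | zero =>
    intro p k h
    obtain ⟨rfl, rfl⟩ : k = 0 ∧ p = 0 := by omega
    rw [shufOp, shuf_zero_left]; rfl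
  | succ n ih =>
    intro p k h
    rcases k with _ | k
    · rw [shufOp, shuf_zero_right]; rfl
    rcases p with _ | p
    · obtain rfl : k = n := by omega
      rw [shufOp, shuf_zero_left, binom_self]; rfl
    have e : n - k = p + 1 := by omega
    change (tensMap (BimoduleHom.id _) (D.binom n k)).lin ∘ₗ (D.braidRun (n + 1) (n - k)).lin +
      (tensMap (BimoduleHom.id _) (D.binom n (k + 1))).lin = _
    rw [tensMap_id_lin, tensMap_id_lin, ih (p + 1) k (by omega), ih p (k + 1) (by omega), e,
      braidRun_lin _ _ _ (by omega)]
    exact (congrFun (shuf_succ_succ C.shift D.braidOp p k) (n + 1)).symm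

/-! ### Wedge products of shuffles -/

variable {D}

/-- The run carries a letter to the front past the pair r, r + 1 (counted from zero), which moves
one place right. When r = 0 the run is σ₁σ₂ followed by a double shift: ∧₂σ₁σ₂ factors through ∧₁ by
∧-compatibility, and ∧₁ commutes with double shifts. -/
theorem exists_wedgeAt_comp_run_of_lt (h : D.WedgeCompatible) : ∀ r p n : ℕ, r < p → p + 2 ≤ n →
    ∃ g, (C.wedgeAt (r + 1) n).lin ∘ₗ D.runOp (p + 1) n = g ∘ₗ (C.wedgeAt r n).lin
  | _, 0, _, hr, _ => by omega
  | 0, p + 1, n, _, hn => by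
    obtain ⟨n, rfl⟩ := Nat.exists_eq_add_of_le' (show 3 ≤ n by omega)
    obtain ⟨τ, hτ⟩ := h.exists_braid (C.T n)
    refine ⟨τ ∘ₗ lTens _ (D.runOp p (n + 1)), LinearMap.ext fun t => ?_⟩
    rw [wedgeAt_succ_lin]
    have e : D.runOp (p + 2) (n + 3) t = D.braidFst _ (lTens _ (D.braidFst _).lin
      (lTens _ (lTens _ (D.runOp p (n + 1))) t)) := by
      rw [lTens_comp_apply]; rfl
    change lTens _ (C.wedgeFst _).lin (D.runOp (p + 2) (n + 3) t) =
      τ (lTens _ (D.runOp p (n + 1)) (C.wedgeFst _ t))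
    rw [e, hτ, wedgeFst_lTens_lTens]
  | r + 1, p + 1, n, hr, hn => by
    obtain ⟨n, rfl⟩ := Nat.exists_eq_add_of_le' (show 2 ≤ n by omega)
    obtain ⟨g, hg⟩ := exists_wedgeAt_comp_run_of_lt h r p (n + 1) (by omega) (by omega)
    refine ⟨(D.braidFst (C.W r n)).lin ∘ₗ lTens _ g, LinearMap.ext fun t => ?_⟩
    rw [wedgeAt_succ_lin, wedgeAt_succ_lin]
    rw [wedgeAt_succ_lin] at hg
    change lTens _ (lTens _ (C.wedgeAt r n).lin) (D.braidFst _ (lTens _ (D.runOp (p + 1) _) t)) =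
      D.braidFst _ (lTens _ g ((C.wedgeAt (r + 1) (n + 2)).lin t))
    rw [← braidFst_lTens_lTens, lTens_comp_apply, hg, wedgeAt_succ_lin, ← lTens_comp_apply]

/-- The run and the wedged pair involve disjoint sets of letters. -/
theorem exists_wedgeAt_comp_run_of_gt : ∀ p r n : ℕ, p ≤ r → r + 2 < n →
    ∃ g, (C.wedgeAt (r + 1) n).lin ∘ₗ D.runOp p n = g ∘ₗ (C.wedgeAt (r + 1) n).lin
  | 0, r, n, _, _ => ⟨LinearMap.id, rfl⟩
  | p + 1, 0, n, hr, hn => by omega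
  | p + 1, r + 1, n, hr, hn => by
    obtain ⟨n, rfl⟩ := Nat.exists_eq_add_of_le' (show 2 ≤ n by omega)
    obtain ⟨g, hg⟩ := exists_wedgeAt_comp_run_of_gt p r (n + 1) (by omega) (by omega)
    refine ⟨(D.braidFst (C.W r n)).lin ∘ₗ lTens _ g, LinearMap.ext fun t => ?_⟩
    rw [wedgeAt_succ_lin, wedgeAt_succ_lin]
    rw [wedgeAt_succ_lin] at hg
    change lTens _ (lTens _ (C.wedgeAt r n).lin) (D.braidFst _ (lTens _ (D.runOp p _) t)) =
      D.braidFst _ (lTens _ g (lTens _ (lTens _ (C.wedgeAt r n).lin) t))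
    rw [← braidFst_lTens_lTens, lTens_comp_apply, hg, ← lTens_comp_apply]

/-- The operator carries the adjacent letters p, p + 1 (counted from zero) to the front, keeping
their order. Each induction step moves the pair past one letter by σ₂σ₁, and ∧₁σ₂σ₁ factors through
∧₂ by extendability. -/
theorem exists_wedgeAt_comp_shift_run_mul_run (h : D.Extendable) : ∀ p n : ℕ, p + 2 ≤ n →
    ∃ g, (C.wedgeAt 0 n).lin ∘ₗ (C.shift (D.runOp p) * D.runOp p) n = g ∘ₗ (C.wedgeAt p n).lin
  | 0, n, _ => ⟨LinearMap.id, by simp only [runOp, run_zero, map_one, mul_one]; rfl⟩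
  | p + 1, n, hn => by
    obtain ⟨n, rfl⟩ := Nat.exists_eq_add_of_le' (show 3 ≤ n by omega)
    obtain ⟨g, hg⟩ := exists_wedgeAt_comp_shift_run_mul_run h p (n + 2) (by omega)
    obtain ⟨τ, hτ⟩ := h.exists_braid (C.T n)
    have e : C.shift (D.runOp (p + 1)) * D.runOp (p + 1) =
        C.shift D.braidOp * (D.braidOp * C.shift (C.shift (D.runOp p) * D.runOp p)) := by
      simp only [runOp, run_succ, map_mul, mul_assoc]
      rw [← mul_assoc (C.shift (C.shift (run C.shift D.braidOp p))), ← braidOp_mul_shift_shift,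
        mul_assoc]
    refine ⟨τ ∘ₗ lTens _ g, LinearMap.ext fun t => ?_⟩
    rw [e, wedgeAt_succ_lin]
    change C.wedgeFst _ (lTens _ (D.braidFst _).lin (D.braidFst _ (lTens _
      ((C.shift (D.runOp p) * D.runOp p) (n + 2)) t))) = τ (lTens _ g (lTens _ _ t))
    rw [hτ, lTens_comp_apply, lTens_comp_apply]
    exact congrArg (fun f => τ (lTens _ f t)) hg

/-- The left linear maps on `(Ω¹)^{⊗ n}` which are combinations of maps factoring through some `∧_r`
with `P r`. -/
def wedgeIdeal (C : DGA 𝕜 A) (P : ℕ → Prop) (n : ℕ) (X : Bimodule 𝕜 A) :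
    AddSubgroup (C.T n →ₗ[A] X) :=
  AddSubgroup.closure {f | ∃ r, P r ∧ ∃ g, f = g ∘ₗ (C.wedgeAt r n).lin}

theorem comp_wedgeAt_mem {P : ℕ → Prop} {n r : ℕ} {X : Bimodule 𝕜 A} (hr : P r)
    (g : C.W r n →ₗ[A] X) : g ∘ₗ (C.wedgeAt r n).lin ∈ wedgeIdeal C P n X :=
  AddSubgroup.subset_closure ⟨r, hr, g, rfl⟩

/-- Transports the ideal along f ↦ (id ⊗ f) x; by additivity only the generators, with ∧_r moved up
one place, have to be checked. -/
theorem lTens_comp_mem {P Q : ℕ → Prop} {n : ℕ} {X : Bimodule 𝕜 A}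
    (x : Module.End A (C.T (n + 1)))
    (hx : ∀ r, P r → ∀ g : C.W r n →ₗ[A] X,
      lTens _ g ∘ₗ (C.wedgeAt (r + 1) (n + 1)).lin ∘ₗ x ∈ wedgeIdeal C Q (n + 1) (tens _ X))
    {f : C.T n →ₗ[A] X} (hf : f ∈ wedgeIdeal C P n X) :
    lTens _ f ∘ₗ x ∈ wedgeIdeal C Q (n + 1) (tens _ X) := by
  induction hf using AddSubgroup.closure_induction with
  | mem f hf =>
    obtain ⟨r, hr, g, rfl⟩ := hf
    rw [lTens_comp, LinearMap.comp_assoc, ← wedgeAt_succ_lin]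
    exact hx r hr g
  | zero => rw [lTens_zero, LinearMap.zero_comp]; exact zero_mem _
  | add f g _ _ hf hg => rw [lTens_add, LinearMap.add_comp]; exact add_mem hf hg
  | neg f _ hf => rw [lTens_neg, LinearMap.neg_comp]; exact neg_mem hf

theorem apply_eq_zero_of_mem_wedgeIdeal {P : ℕ → Prop} {n : ℕ} {X : Bimodule 𝕜 A}
    {f : C.T n →ₗ[A] X} (hf : f ∈ wedgeIdeal C P n X) {t : C.T n}
    (ht : ∀ r, P r → C.wedgeAt r n t = 0) : f t = 0 := by
  induction hf using AddSubgroup.closure_induction with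
  | mem f hf =>
    obtain ⟨r, hr, g, rfl⟩ := hf
    rw [LinearMap.comp_apply, BimoduleHom.lin_apply, ht r hr, map_zero]
  | zero => rfl
  | add f g _ _ hf hg => rw [LinearMap.add_apply, hf, hg, add_zero]
  | neg f _ hf => rw [LinearMap.neg_apply, hf, neg_zero]

/-- The condition r + 1 ≠ p says that ∧_r does not straddle the boundary between the blocks. If the
first two letters of the shuffle come from the first block, nothing has moved in front of ∧₁; if
both come from the second, they were an adjacent pair moved to the front. The mixed terms carry the
factor 1 + σ₁, which ∧₁ kills. -/
theorem wedgeAt_zero_comp_shuf_mem (torsionFree : D.TorsionFree) (extendable : D.Extendable)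
    (p q n : ℕ) (h : p + q = n) :
    (C.wedgeAt 0 n).lin ∘ₗ D.shufOp p q n ∈ wedgeIdeal C (fun r => r + 1 ≠ p) n (C.W 0 n) := by
  rcases p with _ | p
  · rw [shufOp, shuf_zero_left]
    exact comp_wedgeAt_mem (r := 0) (P := fun r => r + 1 ≠ 0) (by omega) LinearMap.id
  rcases q with _ | q
  · rw [shufOp, shuf_zero_right]
    rcases p with _ | p
    · rw [wedgeAt_of_le _ _ _ (by omega), LinearMap.zero_comp]
      exact zero_mem _
    · exact comp_wedgeAt_mem (r := 0) (P := fun r => r + 1 ≠ p + 1 + 1) (by omega) LinearMap.id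
  obtain ⟨n, rfl⟩ := Nat.exists_eq_add_of_le' (show 2 ≤ n by omega)
  -- The recursion for the second letter. The correction operators x and y vanish when the block in
  -- question has only one letter, so both cases fit one formula.
  have e1 : ∃ x : C.Ops, (q = 0 → x = 0) ∧ D.shufOp (p + 1) q =
      C.shift x * D.runOp (p + 1) + C.shift (D.shufOp p q) := by
    rcases q with _ | q
    · exact ⟨0, fun _ => rfl, by simp [shuf_zero_right]⟩
    · exact ⟨_, by omega, shuf_succ_succ _ _ _ _⟩
  have e2 : ∃ y : C.Ops, (p = 0 → y = 0) ∧ D.shufOp p (q + 1) =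
      C.shift (D.shufOp p q) * D.runOp p + C.shift y := by
    rcases p with _ | p
    · exact ⟨0, fun _ => rfl, by simp [shuf_zero_left, run_zero]⟩
    · exact ⟨_, by omega, shuf_succ_succ _ _ _ _⟩
  obtain ⟨x, hx0, hx⟩ := e1
  obtain ⟨y, hy0, hy⟩ := e2
  -- The summands record the origin of the first two letters: both from the second block, both from
  -- the first, one from each in either order.
  have e3 : D.shufOp (p + 1) (q + 1) =
      C.shift (C.shift x) * (C.shift (D.runOp (p + 1)) * D.runOp (p + 1)) +
      C.shift (C.shift y) + C.shift (C.shift (D.shufOp p q)) * ((D.braidOp + 1) *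
        C.shift (D.runOp p)) := by
    rw [shufOp, shuf_succ_succ]
    change C.shift (D.shufOp (p + 1) q) * D.runOp (p + 1) + C.shift (D.shufOp p (q + 1)) = _
    rw [hx, hy]
    simp only [map_add, map_mul, add_mul, mul_add, runOp, run_succ, one_mul, mul_assoc]
    abel
  have nat : ∀ (z v : C.Ops), (C.wedgeAt 0 (n + 2)).lin ∘ₗ (C.shift (C.shift z) * v) (n + 2) =
      lTens _ (z n) ∘ₗ (C.wedgeAt 0 (n + 2)).lin ∘ₗ v (n + 2) := fun z v =>
    LinearMap.ext fun t => wedgeFst_lTens_lTens (z n) _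
  have nat' : ∀ (z : C.Ops), (C.wedgeAt 0 (n + 2)).lin ∘ₗ (C.shift (C.shift z)) (n + 2) =
      lTens _ (z n) ∘ₗ (C.wedgeAt 0 (n + 2)).lin := fun z =>
    LinearMap.ext fun t => wedgeFst_lTens_lTens (z n) _
  have cancel : (C.wedgeAt 0 (n + 2)).lin ∘ₗ ((D.braidOp + 1) * C.shift (D.runOp p)) (n + 2) = 0 :=
    LinearMap.ext fun t => by
      change C.wedgeFst _ (D.braidFst _ (C.shift (D.runOp p) (n + 2) t) +
        C.shift (D.runOp p) (n + 2) t) = 0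
      rw [map_add, torsionFree.wedgeFst_braidFst, neg_add_cancel]
  rw [e3, Pi.add_apply, Pi.add_apply, LinearMap.comp_add, LinearMap.comp_add, nat, nat', nat,
    cancel, LinearMap.comp_zero, add_zero]
  refine add_mem ?_ ?_
  · rcases q with _ | q
    · rw [hx0 rfl]
      change lTens _ 0 ∘ₗ _ ∈ _
      rw [lTens_zero, LinearMap.zero_comp]
      exact zero_mem _
    obtain ⟨g, hg⟩ := exists_wedgeAt_comp_shift_run_mul_run extendable (p + 1) (n + 2) (by omega)
    rw [hg, ← LinearMap.comp_assoc]
    exact comp_wedgeAt_mem (r := p + 1) (P := fun r => r + 1 ≠ p + 1) (by omega) _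
  · rcases p with _ | p
    · rw [hy0 rfl]
      change lTens _ 0 ∘ₗ _ ∈ _
      rw [lTens_zero, LinearMap.zero_comp]
      exact zero_mem _
    · exact comp_wedgeAt_mem (r := 0) (P := fun r => r + 1 ≠ p + 1 + 1) (by omega) _

/-- Splitting off the first letter of the shuffle moves ∧ one place towards the front. When that
letter came from the second block, the factor ∧ provided by induction must still be moved past its
run. -/
theorem wedgeAt_comp_shuf_mem (torsionFree : D.TorsionFree)
    (wedgeCompatible : D.WedgeCompatible) (extendable : D.Extendable)
    (m : ℕ) : ∀ p q n : ℕ, p + q = n →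
    (C.wedgeAt m n).lin ∘ₗ D.shufOp p q n ∈ wedgeIdeal C (fun r => r + 1 ≠ p) n (C.W m n) := by
  induction m with
  | zero => exact wedgeAt_zero_comp_shuf_mem torsionFree extendable
  | succ m ih =>
    intro p q n h
    by_cases hm : n ≤ m + 2
    · rw [wedgeAt_of_le _ _ _ hm, LinearMap.zero_comp]
      exact zero_mem _
    rcases p with _ | p
    · rw [shufOp, shuf_zero_left]
      exact comp_wedgeAt_mem (r := m + 1) (P := fun r => r + 1 ≠ 0) (by omega) LinearMap.id
    rcases q with _ | q
    · rw [shufOp, shuf_zero_right]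
      exact comp_wedgeAt_mem (r := m + 1) (P := fun r => r + 1 ≠ p + 1) (by omega) LinearMap.id
    obtain ⟨n, rfl⟩ := Nat.exists_eq_add_of_le' (show 1 ≤ n by omega)
    have e : (C.wedgeAt (m + 1) (n + 1)).lin ∘ₗ D.shufOp (p + 1) (q + 1) (n + 1) =
        lTens _ ((C.wedgeAt m n).lin ∘ₗ D.shufOp (p + 1) q n) ∘ₗ D.runOp (p + 1) (n + 1) +
        lTens _ ((C.wedgeAt m n).lin ∘ₗ D.shufOp p (q + 1) n) ∘ₗ LinearMap.id := by
      rw [shufOp, shuf_succ_succ, wedgeAt_succ_lin, lTens_comp, lTens_comp, LinearMap.comp_id,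
        LinearMap.comp_assoc, ← LinearMap.comp_add]
      rfl
    rw [e]
    refine add_mem (lTens_comp_mem _ ?_ (ih _ _ _ (by omega)))
      (lTens_comp_mem _ ?_ (ih _ _ _ (by omega)))
    · intro r hr g
      by_cases hn : n ≤ r + 1
      · rw [wedgeAt_of_le _ _ _ (by omega : n + 1 ≤ r + 1 + 1), LinearMap.zero_comp,
          LinearMap.comp_zero]
        exact zero_mem _
      -- Below p the run passes over the pair, and ∧ is pulled back to r. Since r = p is excluded by
      -- `hr`, the pair otherwise lies beyond the run and keeps its place r + 1, within the second
      -- block.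
      rcases lt_or_ge r p with hp | hp
      · obtain ⟨g', hg'⟩ := exists_wedgeAt_comp_run_of_lt wedgeCompatible r p (n + 1) hp (by omega)
        rw [hg', ← LinearMap.comp_assoc]
        exact comp_wedgeAt_mem (r := r) (P := fun r => r + 1 ≠ p + 1) (by omega) _
      · obtain ⟨g', hg'⟩ := exists_wedgeAt_comp_run_of_gt (D := D) (p + 1) r (n + 1)
          (by omega) (by omega)
        rw [hg', ← LinearMap.comp_assoc]
        exact comp_wedgeAt_mem (r := r + 1) (P := fun r => r + 1 ≠ p + 1) (by omega) _
    · intro r hr g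
      exact comp_wedgeAt_mem (r := r + 1) (P := fun r => r + 1 ≠ p + 1) (by omega) _

end BimoduleConnection

/-! ### Concatenation -/

namespace DGA

variable (C : DGA 𝕜 A)

/-- Concatenation of tensors. -/
def cat {i j : ℕ} (x : C.T i) (y : C.T j) : C.T (j + i) := C.concat j i (tmul x y)

variable {C}

theorem T_succ_induction {i : ℕ} {p : C.T (i + 1) → Prop} (x : C.T (i + 1)) (hz : p 0)
    (ht : ∀ (e : C.form 1) (t : C.T i), p (tmul e t)) (ha : ∀ x y, p x → p y → p (x + y)) : p x :=
  tens_induction x hz ht ha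

theorem cat_succ {i j : ℕ} (e : C.form 1) (x : C.T i) (y : C.T j) :
    C.cat (i := i + 1) (tmul e x) y = tmul e (C.cat x y) := rfl

theorem cat_add_left {i j : ℕ} (x x' : C.T i) (y : C.T j) :
    C.cat (x + x') y = C.cat x y + C.cat x' y := by
  rw [cat, tmul_add_left, map_add]; rfl

theorem cat_zero_left {i j : ℕ} (y : C.T j) : C.cat (0 : C.T i) y = 0 := by
  rw [cat, tmul_zero_left, map_zero]

variable (C) in
/-- Concatenation with a fixed tensor on the right. -/
def catRight (i : ℕ) {j : ℕ} (y : C.T j) : C.T i →ₗ[A] C.T (j + i) :=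
  (C.concat j i).lin ∘ₗ ins _ y

theorem catRight_apply {i j : ℕ} (x : C.T i) (y : C.T j) : C.catRight i y x = C.cat x y := rfl

theorem catRight_succ (i : ℕ) {j : ℕ} (y : C.T j) :
    C.catRight (i + 1) y = lTens (C.form 1) (C.catRight i y) := tens_hom_ext fun _ _ => rfl

theorem exists_wedgeAt_comp_catRight {j : ℕ} (y : C.T j) : ∀ r i : ℕ, r + 1 < i →
    ∃ g, (C.wedgeAt r (j + i)).lin ∘ₗ C.catRight i y = g ∘ₗ (C.wedgeAt r i).lin
  | 0, i + 2, _ => ⟨lTens _ (C.catRight i y), LinearMap.ext fun t => by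
      rw [catRight_succ, catRight_succ]
      exact wedgeFst_lTens_lTens _ t⟩
  | r + 1, i + 1, h => by
    obtain ⟨g, hg⟩ := exists_wedgeAt_comp_catRight y r i (by omega)
    refine ⟨lTens _ g, ?_⟩
    rw [wedgeAt_succ_lin, ← lTens_comp, ← hg, lTens_comp, ← catRight_succ, ← wedgeAt_succ_lin]
    rfl

theorem wedgeAt_cat_eq_zero {r j : ℕ} {y : C.T j} (hy : C.wedgeAt r j y = 0) :
    ∀ (i : ℕ) (x : C.T i), C.wedgeAt (r + i) (j + i) (C.cat x y) = 0
  | 0, a => by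
    have h : ∀ b : A, C.wedgeAt r j (b • y) = 0 := fun b => by
      rw [BimoduleHom.map_left, hy, smul_zero]
    exact h a
  | i + 1, x => by
    induction x using T_succ_induction with
    | hz => rw [cat_zero_left, map_zero]
    | ha x x' hx hx' => rw [cat_add_left, map_add, hx, hx', add_zero]
    | ht e x =>
      change tmul e (C.wedgeAt (r + i) (j + i) (C.cat x y)) = 0
      rw [wedgeAt_cat_eq_zero hy i x, tmul_zero_right]

/-- Operators acting on the right factor of a concatenation. -/
theorem cat_ops_right {j : ℕ} (x : C.Ops) (y : C.T j) : ∀ (i : ℕ) (t : C.T i),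
    C.cat t (x j y) = C.shift^[i] x (j + i) (C.cat t y)
  -- Concatenation with a scalar is the left action, so this is left linearity.
  | 0, a => (LinearMap.map_smul (R := A) (x j) a y).symm
  | i + 1, t => by
    induction t using T_succ_induction with
    | hz => rw [cat_zero_left, cat_zero_left, map_zero]
    | ha t t' ht ht' => rw [cat_add_left, cat_add_left, ht, ht', map_add]
    | ht e t =>
      rw [cat_succ, cat_ops_right x y i t, Function.iterate_succ_apply']
      rfl

/-! ### The total space -/

variable (C) in
/-- The action of a family of operators on the total space. -/
def onTotal (x : C.Ops) : C.Total →ₗ[𝕜] C.Total :=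
  DirectSum.toModule 𝕜 ℕ _ fun n => C.incl n ∘ₗ (x n).restrictScalars 𝕜

@[simp]
theorem onTotal_incl (x : C.Ops) (n : ℕ) (t : C.T n) :
    C.onTotal x (C.incl n t) = C.incl n (x n t) := by
  simp [onTotal]

theorem total_induction {p : C.Total → Prop} (x : C.Total) (hz : p 0)
    (hi : ∀ n t, p (C.incl n t)) (ha : ∀ x y, p x → p y → p (x + y)) : p x :=
  DirectSum.induction_on x hz hi ha

theorem total_ext {X : Type*} [AddCommGroup X] [Module 𝕜 X] {f g : C.Total →ₗ[𝕜] X}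
    (h : ∀ n t, f (C.incl n t) = g (C.incl n t)) : f = g :=
  DirectSum.linearMap_ext _ fun n => LinearMap.ext fun t => h n t

theorem onTotal_mul (x y : C.Ops) (t : C.Total) :
    C.onTotal (x * y) t = C.onTotal x (C.onTotal y t) := by
  have : C.onTotal (x * y) = C.onTotal x ∘ₗ C.onTotal y := total_ext fun n t => by
    rw [LinearMap.comp_apply, onTotal_incl, onTotal_incl, onTotal_incl]; rfl
  exact LinearMap.congr_fun this t

theorem onTotal_one (t : C.Total) : C.onTotal 1 t = t := by
  have : C.onTotal 1 = LinearMap.id := total_ext fun n t => by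
    rw [onTotal_incl]; rfl
  exact LinearMap.congr_fun this t

theorem onTotal_add (x y : C.Ops) (t : C.Total) :
    C.onTotal (x + y) t = C.onTotal x t + C.onTotal y t := by
  have : C.onTotal (x + y) = C.onTotal x + C.onTotal y := total_ext fun n t => by
    rw [LinearMap.add_apply, onTotal_incl, onTotal_incl, onTotal_incl, ← map_add]; rfl
  exact LinearMap.congr_fun this t

variable (C) in
/-- Tensoring with an element of `Ω¹` on the left. -/
def cons (e : C.form 1) : C.Total →ₗ[𝕜] C.Total :=
  DirectSum.toModule 𝕜 ℕ _ fun n => C.incl (n + 1) ∘ₗ tmulHom (C.form 1) (C.T n) e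

theorem cons_incl (e : C.form 1) (n : ℕ) (t : C.T n) :
    C.cons e (C.incl n t) = C.incl (n + 1) (tmul e t) := by
  simp [cons]

theorem onTotal_shift_cons (x : C.Ops) (e : C.form 1) (t : C.Total) :
    C.onTotal (C.shift x) (C.cons e t) = C.cons e (C.onTotal x t) := by
  have : C.onTotal (C.shift x) ∘ₗ C.cons e = C.cons e ∘ₗ C.onTotal x := total_ext fun n t => by
    rw [LinearMap.comp_apply, LinearMap.comp_apply, cons_incl, onTotal_incl, onTotal_incl,
      cons_incl]
    rfl
  exact LinearMap.congr_fun this t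

/-- The two bracketings have degrees that are equal only propositionally. Comparing them in the
total space avoids transport between tensor powers. -/
theorem incl_cat_assoc {j k : ℕ} (y : C.T j) (z : C.T k) : ∀ (i : ℕ) (x : C.T i),
    C.incl (k + (j + i)) (C.cat (C.cat x y) z) = C.incl (k + j + i) (C.cat x (C.cat y z))
  | 0, a => congrArg (C.incl (k + j)) ((C.concat k j).map_left (a : A) (tmul y z))
  | i + 1, x => by
    induction x using T_succ_induction with
    | hz => simp only [cat_zero_left, map_zero]
    | ha x x' hx hx' =>
      rw [cat_add_left, cat_add_left, cat_add_left, map_add, map_add, hx, hx']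
    | ht e x =>
      have h := congrArg (C.cons e) (incl_cat_assoc y z i x)
      rw [cons_incl, cons_incl] at h
      exact h

theorem incl_cat_one : ∀ (i : ℕ) (x : C.T i),
    C.incl (0 + i) (C.cat x (regularOne 𝕜 A : C.T 0)) = C.incl i x
  | 0, a => congrArg (C.incl 0) (mul_one (M := A) a)
  | i + 1, x => by
    induction x using T_succ_induction with
    | hz => simp only [cat_zero_left, map_zero]
    | ha x x' hx hx' => rw [cat_add_left, map_add, map_add, ← hx, ← hx', ← map_add]
    | ht e x =>
      have h := congrArg (C.cons e) (incl_cat_one i x)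
      rw [cons_incl, cons_incl] at h
      exact h

end DGA

namespace BimoduleConnection

open DGA

variable {C : DGA 𝕜 A} {D : BimoduleConnection C}

/-! ### Braided shuffles and concatenation -/

theorem shift_comp_catRight {i j : ℕ} {x : C.Ops} {y : C.T j}
    (h : x (j + i) ∘ₗ C.catRight i y = C.catRight i y ∘ₗ x i) :
    C.shift x (j + (i + 1)) ∘ₗ C.catRight (i + 1) y =
      C.catRight (i + 1) y ∘ₗ C.shift x (i + 1) := by
  rw [catRight_succ]
  change lTens _ (x (j + i)) ∘ₗ lTens _ (C.catRight i y) =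
    lTens _ (C.catRight i y) ∘ₗ lTens _ (x i)
  rw [← lTens_comp, h, lTens_comp]

theorem run_comp_catRight {j : ℕ} (y : C.T j) : ∀ p i : ℕ, p + 1 ≤ i →
    D.runOp p (j + i) ∘ₗ C.catRight i y = C.catRight i y ∘ₗ D.runOp p i
  | 0, _, _ => rfl
  | p + 1, i, h => by
    obtain ⟨i, rfl⟩ := Nat.exists_eq_add_of_le' (show 2 ≤ i by omega)
    have h1 := shift_comp_catRight (run_comp_catRight y p (i + 1) (by omega))
    change (D.braidOp (j + (i + 2)) ∘ₗ C.shift (D.runOp p) (j + (i + 2))) ∘ₗ _ =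
      _ ∘ₗ D.braidOp (i + 2) ∘ₗ C.shift (D.runOp p) (i + 2)
    rw [LinearMap.comp_assoc, h1, ← LinearMap.comp_assoc, ← LinearMap.comp_assoc]
    congr 1
    rw [catRight_succ, catRight_succ]
    exact LinearMap.ext fun t => D.braidFst_lTens_lTens _ t

/-- The shuffle involves only the first p + q letters, all of them in the left block, and therefore
commutes with appending y. -/
theorem shuf_comp_catRight {j : ℕ} (y : C.T j) (i : ℕ) : ∀ p q : ℕ, p + q ≤ i →
    D.shufOp p q (j + i) ∘ₗ C.catRight i y = C.catRight i y ∘ₗ D.shufOp p q i := by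
  induction i with
  | zero =>
    intro p q h
    obtain rfl : p = 0 := by omega
    simp only [shufOp, shuf_zero_left]
    rfl
  | succ i ih =>
    intro p q h
    rcases p with _ | p
    · simp only [shufOp, shuf_zero_left]
      rfl
    rcases q with _ | q
    · simp only [shufOp, shuf_zero_right]
      rfl
    have h1 := shift_comp_catRight (ih (p + 1) q (by omega))
    have h2 := shift_comp_catRight (ih p (q + 1) (by omega))
    have h3 := run_comp_catRight (D := D) y (p + 1) (i + 1) (by omega)
    rw [shufOp, shuf_succ_succ]
    change (C.shift (D.shufOp (p + 1) q) (j + (i + 1)) ∘ₗ D.runOp (p + 1) (j + (i + 1)) +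
        C.shift (D.shufOp p (q + 1)) (j + (i + 1))) ∘ₗ _ = _ ∘ₗ
      (C.shift (D.shufOp (p + 1) q) (i + 1) ∘ₗ D.runOp (p + 1) (i + 1) +
        C.shift (D.shufOp p (q + 1)) (i + 1))
    rw [LinearMap.add_comp, LinearMap.comp_add, LinearMap.comp_assoc, h3, ← LinearMap.comp_assoc,
      h1, h2, LinearMap.comp_assoc]

theorem odotAt_tmul {i j : ℕ} (x : C.T i) (y : C.T j) :
    D.odotAt i j (tmul x y) = D.shufOp i j (j + i) (C.cat x y) := by
  rw [← D.binom_lin (j + i) i j rfl]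
  rfl

theorem odot_incl_incl {i j : ℕ} (x : C.T i) (y : C.T j) :
    D.odot (C.incl i x) (C.incl j y) =
      C.onTotal (D.shufOp i j) (C.incl (j + i) (C.cat x y)) := by
  rw [odot_incl, odotAt_tmul, onTotal_incl]

/-- The product `⊙` is associative. -/
theorem LeibnizCompatible.odot_assoc (h : D.LeibnizCompatible) (x y z : C.Total) :
    D.odot (D.odot x y) z = D.odot x (D.odot y z) := by
  induction x using total_induction with
  | hz => simp only [map_zero, LinearMap.zero_apply]
  | ha x x' hx hx' => simp only [map_add, LinearMap.add_apply, hx, hx']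
  | hi i x =>
  induction y using total_induction with
  | hz => simp only [map_zero, LinearMap.zero_apply]
  | ha y y' hy hy' => simp only [map_add, LinearMap.add_apply, hy, hy']
  | hi j y =>
  induction z using total_induction with
  | hz => simp only [map_zero]
  | ha z z' hz hz' => simp only [map_add, hz, hz']
  | hi k z =>
  have h1 : C.cat (D.shufOp i j (j + i) (C.cat x y)) z =
      D.shufOp i j (k + (j + i)) (C.cat (C.cat x y) z) :=
    (LinearMap.congr_fun (shuf_comp_catRight z (j + i) i j (add_comm i j).le) _).symm
  -- The shuffle of x and y acts on the left letters alone, and that of y and z becomes a shift by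
  -- i. Both products are thus operators on the triple concatenation, to be compared by
  -- `shuf_assoc`.
  rw [odot_incl_incl x y, odot_incl_incl y z, onTotal_incl, onTotal_incl, odot_incl_incl,
    odot_incl_incl, h1, cat_ops_right, ← onTotal_incl, ← onTotal_incl, ← onTotal_mul,
    ← onTotal_mul, incl_cat_assoc]
  have h2 := shuf_assoc D.braidOp_mul_shift_shift h.braidOp_braid _ i j k rfl
  rw [add_comm i j, add_comm j k] at h2
  rw [h2]

theorem one_odot (x : C.Total) : D.odot (C.incl 0 (regularOne 𝕜 A)) x = x := by
  have : D.odot (C.incl 0 (regularOne 𝕜 A)) = LinearMap.id := total_ext fun n t => by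
    rw [odot_incl_incl, shufOp, shuf_zero_left, onTotal_one]
    exact congrArg (C.incl n) (one_smul A t)
  exact LinearMap.congr_fun this x

theorem odot_one (x : C.Total) : D.odot x (C.incl 0 (regularOne 𝕜 A)) = x := by
  have : D.odot.flip (C.incl 0 (regularOne 𝕜 A)) = LinearMap.id := total_ext fun n t => by
    rw [LinearMap.flip_apply, odot_incl_incl, shufOp, shuf_zero_right, onTotal_one, incl_cat_one]
    rfl
  exact LinearMap.congr_fun this x

/-- After a shuffle, ∧ factors through those ∧_r that do not straddle the two blocks. On x ⊗ y such
a pair lies inside x, inside y or out of range, and vanishes in each case. -/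
theorem odotAt_mem_quantumSymmetric (torsionFree : D.TorsionFree)
    (wedgeCompatible : D.WedgeCompatible) (extendable : D.Extendable) {i j : ℕ}
    {x : C.T i} {y : C.T j} (hx : x ∈ C.quantumSymmetric i) (hy : y ∈ C.quantumSymmetric j) :
    D.odotAt i j (tmul x y) ∈ C.quantumSymmetric (j + i) := by
  rw [mem_quantumSymmetric] at *
  intro m _
  rw [odotAt_tmul]
  refine apply_eq_zero_of_mem_wedgeIdeal
    (wedgeAt_comp_shuf_mem torsionFree wedgeCompatible extendable m i j (j + i) (add_comm _ _))
    fun r hr => ?_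
  rcases lt_or_gt_of_ne hr with hr | hr
  · obtain ⟨g, hg⟩ := exists_wedgeAt_comp_catRight y r i hr
    have h1 := LinearMap.congr_fun hg x
    rw [LinearMap.comp_apply, LinearMap.comp_apply, BimoduleHom.lin_apply (C.wedgeAt r i), hx r hr,
      map_zero] at h1
    exact h1
  · obtain ⟨s, rfl⟩ := Nat.exists_eq_add_of_le' (show i ≤ r by omega)
    by_cases hs : s + 1 < j
    · exact wedgeAt_cat_eq_zero (hy s hs) i x
    · exact LinearMap.congr_fun (C.wedgeAt_of_le (s + i) (j + i) (by omega)) _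

/-! ### Higher derivatives of products -/

variable (D) in
/-- The tensor power connections, on the total space. -/
def connTotal : C.Total →ₗ[𝕜] C.Total :=
  DirectSum.toModule 𝕜 ℕ _ fun n => C.incl (n + 1) ∘ₗ (D.connAt n).toLinearMap

theorem connTotal_incl (n : ℕ) (t : C.T n) :
    D.connTotal (C.incl n t) = C.incl (n + 1) (D.connAt n t) := by
  simp [connTotal]

variable (D) in
/-- `∇` commutes with the operator `x`, up to a shift. -/
def CommutesWithConn (x : C.Ops) : Prop :=
  ∀ n (t : C.T n), D.connAt n (x n t) = C.shift x (n + 1) (D.connAt n t)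

theorem CommutesWithConn.add {x y : C.Ops} (hx : D.CommutesWithConn x)
    (hy : D.CommutesWithConn y) : D.CommutesWithConn (x + y) := fun n t => by
  rw [Pi.add_apply, LinearMap.add_apply, map_add, hx, hy, map_add]; rfl

theorem CommutesWithConn.mul {x y : C.Ops} (hx : D.CommutesWithConn x)
    (hy : D.CommutesWithConn y) : D.CommutesWithConn (x * y) := fun n t => by
  rw [Pi.mul_apply, Module.End.mul_apply, hx, hy, map_mul]; rfl

theorem CommutesWithConn.one : D.CommutesWithConn 1 := fun n t => by
  rw [map_one]; rfl

theorem connAt_succ_tmul (n : ℕ) (e : C.form 1) (t : C.T n) :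
    D.connAt (n + 1) (tmul e t) =
      lTens _ (ins _ t) (D.nabla e) + D.braidFst _ (tmul e (D.connAt n t)) := by
  rw [← assocR_eq_lTens]; rfl

/-- Immediate from ∇(e ⊗ t) = ∇e ⊗ t + σ₁(e ⊗ ∇t), as σ₁ is natural in the letters beyond the first
two. -/
theorem CommutesWithConn.shift {x : C.Ops} (hx : D.CommutesWithConn x) :
    D.CommutesWithConn (C.shift x)
  | 0, t => hx 0 t
  | n + 1, t => by
    change D.connAt (n + 1) (lTens _ (x n) t) = lTens _ (lTens _ (x n)) (D.connAt (n + 1) t)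
    induction t using T_succ_induction with
    | hz => simp
    | ha t t' ht ht' => simp only [map_add, ht, ht']
    | ht e t =>
      rw [lTens_tmul, connAt_succ_tmul, connAt_succ_tmul, hx, map_add, lTens_comp_apply,
        ← braidFst_lTens_lTens]
      rfl

theorem LeibnizCompatible.commutesWithConn_braidOp (h : D.LeibnizCompatible) :
    D.CommutesWithConn D.braidOp
  | 0, t => by
    have h0 : C.shift D.braidOp 1 = 0 := lTens_zero
    rw [h0]
    exact map_zero (D.connAt 0).toLinearMap
  | 1, t => by
    have h0 : C.shift D.braidOp 2 = 0 := lTens_zero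
    rw [h0]
    exact map_zero (D.connAt 1).toLinearMap
  | n + 2, t => h.tensConn_tensConn_braidFst (D.connAt n) t

theorem LeibnizCompatible.commutesWithConn_run (h : D.LeibnizCompatible) :
    ∀ p, D.CommutesWithConn (D.runOp p)
  | 0 => CommutesWithConn.one
  | p + 1 => h.commutesWithConn_braidOp.mul (h.commutesWithConn_run p).shift

/-- Shuffles are noncommutative polynomials in the shifts of σ, so the claim reduces to that for σ,
which is Leibniz compatibility with a tail. -/
theorem LeibnizCompatible.commutesWithConn_shuf (h : D.LeibnizCompatible) (n : ℕ) :
    ∀ p q, p + q = n → D.CommutesWithConn (D.shufOp p q) := by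
  induction n with
  | zero =>
    intro p q hn
    obtain rfl : p = 0 := by omega
    rw [shufOp, shuf_zero_left]
    exact CommutesWithConn.one
  | succ n ih =>
    intro p q hn
    rcases p with _ | p
    · rw [shufOp, shuf_zero_left]
      exact CommutesWithConn.one
    rcases q with _ | q
    · rw [shufOp, shuf_zero_right]
      exact CommutesWithConn.one
    rw [shufOp, shuf_succ_succ]
    exact ((ih _ _ (by omega)).shift.mul (h.commutesWithConn_run _)).add
      (ih _ _ (by omega)).shift

theorem CommutesWithConn.connTotal_onTotal {x : C.Ops} (hx : D.CommutesWithConn x) (t : C.Total) :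
    D.connTotal (C.onTotal x t) = C.onTotal (C.shift x) (D.connTotal t) := by
  have : D.connTotal ∘ₗ C.onTotal x = C.onTotal (C.shift x) ∘ₗ D.connTotal :=
    total_ext fun n t => by
      rw [LinearMap.comp_apply, LinearMap.comp_apply, onTotal_incl, connTotal_incl, connTotal_incl,
        onTotal_incl, hx]
  exact LinearMap.congr_fun this t

theorem connTotal_incl_succ (n : ℕ) (e : C.form 1) (t : C.T n) :
    D.connTotal (C.incl (n + 1) (tmul e t)) = C.incl (n + 2) (lTens _ (ins _ t) (D.nabla e)) +
      C.onTotal D.braidOp (C.cons e (D.connTotal (C.incl n t))) := by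
  rw [connTotal_incl, connTotal_incl, cons_incl, onTotal_incl, connAt_succ_tmul, map_add]
  rfl

/-- The Leibniz rule of `∇` for concatenations. -/
theorem connTotal_incl_cat {j : ℕ} (y : C.T j) : ∀ (i : ℕ) (x : C.T i),
    D.connTotal (C.incl (j + i) (C.cat x y)) =
      C.incl (j + (i + 1)) (C.cat (i := i + 1) (D.connAt i x) y) +
        C.onTotal (D.runOp i) (C.incl (j + 1 + i) (C.cat (j := j + 1) x (D.connAt j y)))
  | 0, a => by
    have h := (D.connAt j).leibniz a y
    have h1 : C.cat (i := 1) (D.connAt 0 a) y = tmul (C.d₀ a) y := by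
      change tmul (C.d₀ a) ((1 : A) • y) = _
      rw [one_smul]
    rw [runOp, run_zero, onTotal_one, h1]
    change D.connTotal (C.incl j (HSMul.hSMul (α := A) a y)) = _
    rw [connTotal_incl, h, map_add]
    rfl
  | i + 1, x => by
    induction x using T_succ_induction with
    | hz => simp only [cat_zero_left, map_zero, add_zero]
    | ha x x' hx hx' =>
      have h1 : C.cat (i := i + 2) (D.connAt (i + 1) (x + x')) y =
          C.cat (i := i + 2) (D.connAt (i + 1) x) y +
            C.cat (i := i + 2) (D.connAt (i + 1) x') y := by
        rw [map_add]; exact cat_add_left (i := i + 2) _ _ _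
      rw [h1, cat_add_left, cat_add_left, map_add, map_add, map_add, map_add, map_add, hx, hx']
      abel
    | ht e x =>
      have h1 : C.cat (i := i + 2) (D.connAt (i + 1) (tmul e x)) y =
          lTens _ (ins _ (C.cat x y)) (D.nabla e) +
            D.braidFst _ (tmul e (C.cat (i := i + 1) (D.connAt i x) y)) := by
        rw [connAt_succ_tmul, cat_add_left, ← catRight_apply, ← catRight_apply, catRight_succ,
          catRight_succ, ← braidFst_lTens_lTens, lTens_comp_apply, ← catRight_succ]
        rfl
      have h2 : C.incl (j + 1 + (i + 1)) (C.cat (i := i + 1) (tmul e x)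
          (D.connAt j y : C.T (j + 1))) =
          C.cons e (C.incl (j + 1 + i) (C.cat x (D.connAt j y : C.T (j + 1)))) := by
        rw [cons_incl]; rfl
      have h3 : D.runOp (i + 1) = D.braidOp * C.shift (D.runOp i) := rfl
      -- ∇ differentiates either the first letter or the rest. In the second case the new form is
      -- moved to the front of the rest by the run of length i, and past e by σ₁, giving the run of
      -- length i + 1.
      change D.connTotal (C.incl (j + i + 1) (tmul e (C.cat x y))) = _
      rw [connTotal_incl_succ, connTotal_incl_cat y i x, h1, h2, map_add, map_add, map_add,
        cons_incl, onTotal_incl, h3, onTotal_mul, onTotal_shift_cons]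
      exact (add_assoc _ _ _).symm

variable (D) in
/-- `∇^n a`, in the total space. -/
abbrev pow (n : ℕ) (a : A) : C.Total := C.incl n (D.nablaPow n a)

theorem connTotal_pow (n : ℕ) (a : A) : D.connTotal (D.pow n a) = D.pow (n + 1) a :=
  connTotal_incl _ _

/-- The higher derivatives of a product. -/
theorem LeibnizCompatible.pow_mul (h : D.LeibnizCompatible) (a b : A) (n : ℕ) :
    D.pow n (a * b) =
      ∑ p ∈ Finset.HasAntidiagonal.antidiagonal n, D.odot (D.pow p.1 a) (D.pow p.2 b) := by
  let m : ℕ → ℕ → C.Total := fun i j =>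
    C.incl (j + i) (C.cat (D.nablaPow i a) (D.nablaPow j b))
  have hm : ∀ i j, D.odot (D.pow i a) (D.pow j b) = C.onTotal (D.shufOp i j) (m i j) :=
    fun i j => odot_incl_incl _ _
  have hc : ∀ i j, D.connTotal (m i j) = m (i + 1) j + C.onTotal (D.runOp i) (m i (j + 1)) :=
    fun i j => connTotal_incl_cat _ _ _
  induction n with
  | zero =>
    rw [Finset.Nat.antidiagonal_zero, Finset.sum_singleton, hm, shufOp, shuf_zero_left, onTotal_one]
    rfl
  | succ n ih =>
    -- P collects the terms in which the last derivative fell on a, Q those in which it fell on b.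
    -- Their sum is the shuffle recursion; the zero values cover the case where a or b has not been
    -- differentiated.
    let P : ℕ → ℕ → C.Total := fun i j => match i with
      | 0 => 0
      | i + 1 => C.onTotal (C.shift (D.shufOp i j)) (m (i + 1) j)
    let Q : ℕ → ℕ → C.Total := fun i j => match j with
      | 0 => 0
      | j + 1 => C.onTotal (C.shift (D.shufOp i j)) (C.onTotal (D.runOp i) (m i (j + 1)))
    have hPQ : ∀ p ∈ Finset.HasAntidiagonal.antidiagonal (n + 1),
        D.odot (D.pow p.1 a) (D.pow p.2 b) = P p.1 p.2 + Q p.1 p.2 := by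
      rintro ⟨i, j⟩ hp
      rw [hm]
      rcases i with _ | i
      · rcases j with _ | j
        · simp at hp
        · simp only [P, Q, shufOp, shuf_zero_left, runOp, run_zero, map_one, onTotal_one, zero_add]
      · rcases j with _ | j
        · simp only [P, Q, shufOp, shuf_zero_right, map_one, onTotal_one, add_zero]
        · simp only [P, Q]
          rw [shufOp, shuf_succ_succ, onTotal_add, onTotal_mul, add_comm]
    rw [Finset.sum_congr rfl hPQ, Finset.sum_add_distrib,
      Finset.Nat.sum_antidiagonal_succ (f := fun p => P p.1 p.2),
      Finset.Nat.sum_antidiagonal_succ' (f := fun p => Q p.1 p.2), ← connTotal_pow, ih, map_sum]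
    simp only [P, Q, zero_add, ← Finset.sum_add_distrib]
    -- After reindexing, the claim holds term by term: move ∇ past the shuffle, then apply the
    -- Leibniz rule for concatenation.
    refine Finset.sum_congr rfl fun p _ => ?_
    rw [hm, (h.commutesWithConn_shuf _ _ _ rfl).connTotal_onTotal, hc, map_add]

end BimoduleConnection

/-! ### Truncation -/

namespace DGA

variable (C : DGA 𝕜 A)

/-- Truncation of the total space at degree `k`. -/
def trunc (k : ℕ) : C.Total →ₗ[𝕜] C.Total :=
  DirectSum.toModule 𝕜 ℕ _ fun n => if n ≤ k then C.incl n else 0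

variable {C}

theorem trunc_incl (k n : ℕ) (t : C.T n) :
    C.trunc k (C.incl n t) = if n ≤ k then C.incl n t else 0 := by
  rw [trunc, DirectSum.toModule_lof]
  split_ifs <;> rfl

theorem incl_apply_self (n : ℕ) (t : C.T n) : C.incl n t n = t := by
  rw [DirectSum.lof_apply]

theorem incl_apply_of_ne {n i : ℕ} (h : i ≠ n) (t : C.T n) : C.incl n t i = 0 :=
  DFinsupp.single_eq_of_ne (β := fun n => C.T n) h

theorem trunc_apply (k : ℕ) (x : C.Total) (i : ℕ) :
    C.trunc k x i = if i ≤ k then x i else 0 := by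
  induction x using total_induction with
  | hz => rw [map_zero, DirectSum.zero_apply, ite_self]
  | ha x y hx hy =>
    rw [map_add, DirectSum.add_apply, DirectSum.add_apply, hx, hy]
    split_ifs
    · rfl
    · rw [add_zero]
  | hi n t =>
    rw [trunc_incl]
    by_cases hin : i = n
    · subst hin
      split_ifs
      · rfl
      · rfl
    · rw [incl_apply_of_ne hin, ite_self]
      split_ifs
      · exact incl_apply_of_ne hin t
      · rfl

theorem trunc_trunc {k l : ℕ} (h : k ≤ l) (x : C.Total) :
    C.trunc k (C.trunc l x) = C.trunc k x := by
  refine DFinsupp.ext fun i => ?_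
  change C.trunc k (C.trunc l x) i = C.trunc k x i
  simp only [trunc_apply]
  split_ifs <;> first | rfl | omega

theorem trunc_of_mem {k : ℕ} {x : C.Total} (hx : x ∈ C.jetSpace k) : C.trunc k x = x := by
  refine DFinsupp.ext fun i => ?_
  change C.trunc k x i = x i
  rw [trunc_apply]
  split_ifs with h
  · rfl
  · exact (hx.2 i (by omega)).symm

variable (C) in
/-- The elements of the total space with quantum symmetric components. -/
def symTotal : Submodule 𝕜 C.Total where
  carrier := {x | ∀ i, x i ∈ C.quantumSymmetric i}
  add_mem' := fun hx hy i => add_mem (hx i) (hy i)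
  zero_mem' := fun _ => zero_mem _
  smul_mem' := fun c _ hx i => Submodule.smul_mem _ c (hx i)

theorem jetSpace_le_symTotal (k : ℕ) : C.jetSpace k ≤ C.symTotal := fun _ hx => hx.1

theorem incl_mem_symTotal {n : ℕ} {t : C.T n} (ht : t ∈ C.quantumSymmetric n) :
    C.incl n t ∈ C.symTotal :=
  jetSpace_le_symTotal n (C.incl_mem_jetSpace le_rfl ht)

theorem trunc_mem_jetSpace (k : ℕ) {x : C.Total} (hx : x ∈ C.symTotal) :
    C.trunc k x ∈ C.jetSpace k := by
  refine ⟨fun i => ?_, fun i hi => ?_⟩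
  · rw [trunc_apply]
    split_ifs
    · exact hx i
    · exact zero_mem _
  · rw [trunc_apply, if_neg (by omega)]

theorem symTotal_induction {p : C.Total → Prop} {x : C.Total} (hx : x ∈ C.symTotal) (hz : p 0)
    (hi : ∀ n t, t ∈ C.quantumSymmetric n → p (C.incl n t))
    (ha : ∀ x y, p x → p y → p (x + y)) : p x := by
  classical
  rw [← DirectSum.sum_support_of x]
  exact Finset.sum_induction _ p (fun x y => ha x y) hz fun i _ => hi i _ (hx i)

end DGA

namespace BimoduleConnection

open DGA

variable {C : DGA 𝕜 A} {D : BimoduleConnection C}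

theorem odot_mem_symTotal (torsionFree : D.TorsionFree)
    (wedgeCompatible : D.WedgeCompatible) (extendable : D.Extendable) {x y : C.Total}
    (hx : x ∈ C.symTotal) (hy : y ∈ C.symTotal) : D.odot x y ∈ C.symTotal := by
  refine symTotal_induction (p := fun x => D.odot x y ∈ C.symTotal) hx ?_ (fun i s hs => ?_)
    fun x x' h h' => ?_
  · simp only [map_zero, LinearMap.zero_apply, zero_mem]
  · refine symTotal_induction (p := fun y => D.odot (C.incl i s) y ∈ C.symTotal) hy ?_ (fun j t ht => ?_)
      fun y y' h h' => ?_
    · simp only [map_zero, zero_mem]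
    · rw [odot_incl]
      exact incl_mem_symTotal
        (odotAt_mem_quantumSymmetric torsionFree wedgeCompatible extendable hs ht)
    · rw [map_add]; exact add_mem h h'
  · rw [map_add]; exact add_mem h h'

/-- Degrees add under ⊙, so components above degree k contribute nothing up to degree k. With the
right-hand version, this makes truncation a quotient by an ideal. -/
theorem trunc_odot_trunc_left (k : ℕ) (x y : C.Total) :
    C.trunc k (D.odot (C.trunc k x) y) = C.trunc k (D.odot x y) := by
  induction x using total_induction with
  | hz => simp only [map_zero]
  | ha x x' hx hx' => simp only [map_add, LinearMap.add_apply, hx, hx']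
  | hi i x =>
  induction y using total_induction with
  | hz => simp only [map_zero]
  | ha y y' hy hy' => simp only [map_add, hy, hy']
  | hi j y =>
  rw [trunc_incl]
  split_ifs with h
  · rfl
  · rw [odot_incl, trunc_incl, if_neg (by omega), map_zero, LinearMap.zero_apply, map_zero]

theorem trunc_odot_trunc_right (k : ℕ) (x y : C.Total) :
    C.trunc k (D.odot x (C.trunc k y)) = C.trunc k (D.odot x y) := by
  induction x using total_induction with
  | hz => simp only [map_zero, LinearMap.zero_apply]
  | ha x x' hx hx' => simp only [map_add, LinearMap.add_apply, hx, hx']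
  | hi i x =>
  induction y using total_induction with
  | hz => simp only [map_zero]
  | ha y y' hy hy' => simp only [map_add, hy, hy']
  | hi j y =>
  rw [trunc_incl]
  split_ifs with h
  · rfl
  · rw [odot_incl, trunc_incl, if_neg (by omega), map_zero, map_zero]

/-! ### Jets -/

theorem jet_apply (k : ℕ) (a : A) : D.jet k a = ∑ i ∈ Finset.range (k + 1), D.pow i a := by
  simp [jet]

theorem trunc_jet {k l : ℕ} (h : k ≤ l) (a : A) : C.trunc k (D.jet l a) = D.jet k a := by
  rw [jet_apply, jet_apply, map_sum]
  simp only [trunc_incl]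
  rw [← Finset.sum_filter]
  refine Finset.sum_congr ?_ fun _ _ => rfl
  ext i
  simp only [Finset.mem_filter, Finset.mem_range]
  omega

theorem jet_mem_jetSpace {s : A} (hs : ∀ n, D.nablaPow n s ∈ C.quantumSymmetric n) (k : ℕ) :
    D.jet k s ∈ C.jetSpace k := by
  rw [jet_apply]
  refine sum_mem fun i hi => C.incl_mem_jetSpace ?_ (hs i)
  rw [Finset.mem_range] at hi
  omega

/-- Truncating a product with the full jet j^k amounts to using j^(k-i) on degree i. This identifies
the truncated product with the bullet action. -/
theorem trunc_jet_odot_incl {k i : ℕ} (h : i ≤ k) (a : A) (t : C.T i) :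
    C.trunc k (D.odot (D.jet k a) (C.incl i t)) = D.odot (D.jet (k - i) a) (C.incl i t) := by
  rw [jet_apply, jet_apply, map_sum, map_sum, LinearMap.sum_apply, LinearMap.sum_apply, map_sum]
  simp only [odot_incl, trunc_incl]
  rw [← Finset.sum_filter]
  refine Finset.sum_congr ?_ fun _ _ => rfl
  ext j
  simp only [Finset.mem_filter, Finset.mem_range]
  omega

theorem trunc_incl_odot_jet {k i : ℕ} (h : i ≤ k) (a : A) (t : C.T i) :
    C.trunc k (D.odot (C.incl i t) (D.jet k a)) = D.odot (C.incl i t) (D.jet (k - i) a) := by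
  rw [jet_apply, jet_apply, map_sum, map_sum, map_sum]
  simp only [odot_incl, trunc_incl]
  rw [← Finset.sum_filter]
  refine Finset.sum_congr ?_ fun _ _ => rfl
  ext j
  simp only [Finset.mem_filter, Finset.mem_range]
  omega

/-- The truncated product is the sum of ∇^i a ⊙ ∇^j b over i + j ≤ k. Regrouped by total degree,
each diagonal is the formula for ∇^n(ab). -/
theorem LeibnizCompatible.jet_mul (h : D.LeibnizCompatible) (k : ℕ) (a b : A) :
    D.jet k (a * b) = C.trunc k (D.odot (D.jet k a) (D.jet k b)) := by
  have e : C.trunc k (D.odot (D.jet k a) (D.jet k b)) = ∑ i ∈ Finset.range (k + 1),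
      ∑ j ∈ Finset.range (k + 1 - i), D.odot (D.pow i a) (D.pow j b) := by
    rw [jet_apply k a, map_sum, LinearMap.sum_apply, map_sum]
    refine Finset.sum_congr rfl fun i hi => ?_
    rw [Finset.mem_range] at hi
    rw [trunc_incl_odot_jet (by omega), jet_apply, map_sum, show k - i + 1 = k + 1 - i by omega]
  rw [e, ← Finset.sum_range_diag_flip (k + 1) fun i j => D.odot (D.pow i a) (D.pow j b), jet_apply]
  refine Finset.sum_congr rfl fun n _ => ?_
  rw [h.pow_mul, Finset.Nat.sum_antidiagonal_eq_sum_range_succ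
    (f := fun i j => D.odot (D.pow i a) (D.pow j b))]

theorem nablaPow_succ_one (n : ℕ) : D.nablaPow (n + 1) 1 = 0 := by
  induction n with
  | zero =>
    have h1 : C.d₀ 1 = 0 := by simpa using C.d₀_mul 1 1
    change tmul (C.d₀ 1) (regularOne 𝕜 A) = 0
    rw [h1, tmul_zero_left]
  | succ n ih =>
    change (D.connAt (n + 1)) (D.nablaPow (n + 1) 1) = 0
    rw [ih, map_zero]

theorem jet_one (k : ℕ) : D.jet k 1 = C.incl 0 (regularOne 𝕜 A) := by
  rw [jet_apply, Finset.sum_range_succ', Finset.sum_eq_zero, zero_add]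
  · rfl
  · intro n _
    rw [pow, nablaPow_succ_one, map_zero]

/-! ### The truncated algebra and its two actions of A -/

variable (D) in
/-- The hypotheses under which the jet bimodules exist. -/
structure JetCompatible : Prop where
  torsionFree : D.TorsionFree
  flat : D.Flat
  wedgeCompatible : D.WedgeCompatible
  extendable : D.Extendable
  leibnizCompatible : D.LeibnizCompatible

namespace JetCompatible

theorem jet_mem (h : D.JetCompatible) (k : ℕ) (a : A) : D.jet k a ∈ C.jetSpace k :=
  jet_mem_jetSpace (fun n => nablaPow_mem_quantumSymmetric h.torsionFree h.flat h.wedgeCompatible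
    h.extendable h.leibnizCompatible a n) k

theorem trunc_odot_mem (h : D.JetCompatible) {k : ℕ} {x y : C.Total} (hx : x ∈ C.jetSpace k)
    (hy : y ∈ C.jetSpace k) : C.trunc k (D.odot x y) ∈ C.jetSpace k :=
  trunc_mem_jetSpace k (odot_mem_symTotal h.torsionFree h.wedgeCompatible h.extendable hx.1 hy.1)

/-- The product of the truncated algebra of quantum symmetric forms. -/
def mul (h : D.JetCompatible) (k : ℕ) (x y : C.jetSpace k) : C.jetSpace k :=
  ⟨C.trunc k (D.odot x y), h.trunc_odot_mem x.2 y.2⟩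

theorem coe_mul (h : D.JetCompatible) (k : ℕ) (x y : C.jetSpace k) :
    (h.mul k x y : C.Total) = C.trunc k (D.odot x y) := rfl

/-- The jet prolongation with values in the jet space. -/
def prolong (h : D.JetCompatible) (k : ℕ) : A →ₗ[𝕜] C.jetSpace k :=
  (D.jet k).codRestrict (C.jetSpace k) (h.jet_mem k)

theorem coe_prolong (h : D.JetCompatible) (k : ℕ) (a : A) :
    (h.prolong k a : C.Total) = D.jet k a := rfl

/-- Inner truncations are absorbed by the outer one, leaving associativity of ⊙. -/
theorem mul_assoc (h : D.JetCompatible) (k : ℕ) (x y z : C.jetSpace k) :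
    h.mul k (h.mul k x y) z = h.mul k x (h.mul k y z) := Subtype.ext (by
  simp only [coe_mul, trunc_odot_trunc_left, trunc_odot_trunc_right,
    h.leibnizCompatible.odot_assoc])

theorem prolong_mul (h : D.JetCompatible) (k : ℕ) (a b : A) :
    h.prolong k (a * b) = h.mul k (h.prolong k a) (h.prolong k b) :=
  Subtype.ext (h.leibnizCompatible.jet_mul k a b)

theorem prolong_one_mul (h : D.JetCompatible) (k : ℕ) (x : C.jetSpace k) :
    h.mul k (h.prolong k 1) x = x := Subtype.ext (by
  rw [coe_mul, coe_prolong, jet_one, one_odot, trunc_of_mem x.2])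

theorem mul_prolong_one (h : D.JetCompatible) (k : ℕ) (x : C.jetSpace k) :
    h.mul k x (h.prolong k 1) = x := Subtype.ext (by
  rw [coe_mul, coe_prolong, jet_one, odot_one, trunc_of_mem x.2])

theorem mul_add (h : D.JetCompatible) (k : ℕ) (x y z : C.jetSpace k) :
    h.mul k x (y + z) = h.mul k x y + h.mul k x z := Subtype.ext (by
  simp only [coe_mul, Submodule.coe_add, map_add])

theorem add_mul (h : D.JetCompatible) (k : ℕ) (x y z : C.jetSpace k) :
    h.mul k (x + y) z = h.mul k x z + h.mul k y z := Subtype.ext (by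
  simp only [coe_mul, Submodule.coe_add, map_add, LinearMap.add_apply])

theorem smul_mul (h : D.JetCompatible) (k : ℕ) (c : 𝕜) (x y : C.jetSpace k) :
    h.mul k (c • x) y = c • h.mul k x y := Subtype.ext (by
  simp only [coe_mul, Submodule.coe_smul, map_smul, LinearMap.smul_apply])

theorem mul_smul (h : D.JetCompatible) (k : ℕ) (c : 𝕜) (x y : C.jetSpace k) :
    h.mul k x (c • y) = c • h.mul k x y := Subtype.ext (by
  simp only [coe_mul, Submodule.coe_smul, map_smul])

theorem mul_zero (h : D.JetCompatible) (k : ℕ) (x : C.jetSpace k) : h.mul k x 0 = 0 := by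
  simpa using h.mul_smul k 0 x 0

theorem zero_mul (h : D.JetCompatible) (k : ℕ) (x : C.jetSpace k) : h.mul k 0 x = 0 := by
  simpa using h.smul_mul k 0 0 x

/-- The left action `a • x = j^k(a) ⊙ x` on the jet space. -/
abbrev leftModule (h : D.JetCompatible) (k : ℕ) : Module A (C.jetSpace k) where
  smul a x := h.mul k (h.prolong k a) x
  one_smul := h.prolong_one_mul k
  mul_smul a b x := by
    change h.mul k (h.prolong k (a * b)) x = h.mul k (h.prolong k a) (h.mul k (h.prolong k b) x)
    rw [prolong_mul, mul_assoc]
  smul_zero a := h.mul_zero k _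
  smul_add a := h.mul_add k _
  add_smul a b x := by
    change h.mul k (h.prolong k (a + b)) x = h.mul k (h.prolong k a) x + h.mul k (h.prolong k b) x
    rw [map_add, add_mul]
  zero_smul x := by
    change h.mul k (h.prolong k 0) x = 0
    rw [map_zero, zero_mul]

/-- The right action `x • a = x ⊙ j^k(a)` on the jet space. -/
abbrev rightModule (h : D.JetCompatible) (k : ℕ) : Module Aᵐᵒᵖ (C.jetSpace k) where
  smul a x := h.mul k x (h.prolong k (unop a))
  one_smul := h.mul_prolong_one k
  mul_smul a b x := by
    change h.mul k x (h.prolong k (unop b * unop a)) =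
      h.mul k (h.mul k x (h.prolong k (unop b))) (h.prolong k (unop a))
    rw [prolong_mul, mul_assoc]
  smul_zero a := h.zero_mul k _
  smul_add a x y := h.add_mul k x y _
  add_smul a b x := by
    change h.mul k x (h.prolong k (unop a + unop b)) =
      h.mul k x (h.prolong k (unop a)) + h.mul k x (h.prolong k (unop b))
    rw [map_add, mul_add]
  zero_smul x := by
    change h.mul k x (h.prolong k 0) = 0
    rw [map_zero, mul_zero]

end JetCompatible

end BimoduleConnection

/-! ### The projections between jet spaces -/

namespace DGA

variable (C : DGA 𝕜 A)

/-- The projection of jet spaces which drops the component of top degree. -/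
def jetProj (k : ℕ) : C.jetSpace (k + 1) →ₗ[𝕜] C.jetSpace k :=
  (C.trunc k).restrict fun _ hx => trunc_mem_jetSpace k hx.1

theorem coe_jetProj (k : ℕ) (x : C.jetSpace (k + 1)) :
    (C.jetProj k x : C.Total) = C.trunc k x := rfl

theorem ker_jetProj (k : ℕ) :
    LinearMap.ker (C.jetProj k) = LinearMap.range (C.jetIncl (le_refl (k + 1))) := by
  ext x
  rw [LinearMap.mem_ker, LinearMap.mem_range]
  constructor
  · intro hx
    refine ⟨⟨(x : C.Total) (k + 1), x.2.1 (k + 1)⟩, Subtype.ext (DFinsupp.ext fun i => ?_)⟩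
    change C.incl (k + 1) ((x : C.Total) (k + 1)) i = (x : C.Total) i
    rcases lt_trichotomy i (k + 1) with hi | rfl | hi
    · have h : C.trunc k x i = 0 :=
        congrArg (fun y : C.Total => y i) (congrArg Subtype.val hx)
      rw [trunc_apply, if_pos (by omega)] at h
      rw [h, incl_apply_of_ne (by omega)]
    · exact incl_apply_self _ _
    · rw [incl_apply_of_ne (by omega), x.2.2 i hi]
  · rintro ⟨y, rfl⟩
    refine Subtype.ext ?_
    change C.trunc k (C.incl (k + 1) y) = 0
    rw [trunc_incl, if_neg (by omega)]

theorem jetProj_surjective (k : ℕ) : Function.Surjective (C.jetProj k) := fun x =>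
  ⟨⟨x, x.2.1, fun i hi => x.2.2 i (by omega)⟩, Subtype.ext (trunc_of_mem x.2)⟩

end DGA

/-- Truncation at k absorbs truncation at k + 1 and may be inserted in either factor. Linearity of
the projection for both actions is the case of a factor j^(k+1)(a). -/
theorem BimoduleConnection.JetCompatible.jetProj_mul {C : DGA 𝕜 A} {D : BimoduleConnection C}
    (h : D.JetCompatible) (k : ℕ) (x y : C.jetSpace (k + 1)) :
    C.jetProj k (h.mul (k + 1) x y) = h.mul k (C.jetProj k x) (C.jetProj k y) :=
  Subtype.ext (by
    simp only [DGA.coe_jetProj, coe_mul, DGA.trunc_trunc (Nat.le_succ k), trunc_odot_trunc_left,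
      trunc_odot_trunc_right])

theorem BimoduleConnection.JetCompatible.jetProj_prolong {C : DGA 𝕜 A} {D : BimoduleConnection C}
    (h : D.JetCompatible) (k : ℕ) (a : A) : C.jetProj k (h.prolong (k + 1) a) = h.prolong k a :=
  Subtype.ext (trunc_jet (Nat.le_succ k) a)

end
end NCJet

/-! ### The jet bimodules -/

theorem theorem4p7 {𝕜 : Type w} {A : Type u} [Field 𝕜] [Ring A] [Algebra 𝕜 A]
    (C : NCJet.DGA 𝕜 A) (D : NCJet.BimoduleConnection C)
    (torsionFree : D.TorsionFree) (flat : D.Flat) (wedgeCompatible : D.WedgeCompatible)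
    (extendable : D.Extendable) (leibnizCompatible : D.LeibnizCompatible) :
    ∃ (_left : ∀ k, Module A (C.jetSpace k)) (_right : ∀ k, Module Aᵐᵒᵖ (C.jetSpace k))
      (j : ∀ k, A →ₗ[𝕜] C.jetSpace k) (π : ∀ k, C.jetSpace (k + 1) →ₗ[𝕜] C.jetSpace k),
      -- the two actions make every jet space a bimodule over the `𝕜`-algebra `A`
      (∀ k, SMulCommClass A Aᵐᵒᵖ (C.jetSpace k) ∧ IsScalarTower 𝕜 A (C.jetSpace k) ∧
        IsScalarTower 𝕜 Aᵐᵒᵖ (C.jetSpace k)) ∧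
      -- they are the bullet actions
      (∀ (k i : ℕ) (h : i ≤ k) (a : A) (ω : C.quantumSymmetric i),
        ((a • C.jetIncl h ω : C.jetSpace k) : C.Total) =
          D.odot (D.jet (k - i) a) (C.incl i ω)) ∧
      (∀ (k i : ℕ) (h : i ≤ k) (a : A) (ω : C.quantumSymmetric i),
        ((MulOpposite.op a • C.jetIncl h ω : C.jetSpace k) : C.Total) =
          D.odot (C.incl i ω) (D.jet (k - i) a)) ∧
      -- the jet prolongation map takes values in the jet space and is a bimodule map
      (∀ (k : ℕ) (s : A), (j k s : C.Total) = D.jet k s) ∧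
      (∀ (k : ℕ) (a s : A), j k (a * s) = a • j k s) ∧
      (∀ (k : ℕ) (a s : A), j k (s * a) = MulOpposite.op a • j k s) ∧
      -- the projection drops the component of top degree
      (∀ (k : ℕ) (x : C.jetSpace (k + 1)) (i : ℕ), i ≤ k →
        (π k x : C.Total) i = (x : C.Total) i) ∧
      (∀ k : ℕ, LinearMap.ker (π k) = LinearMap.range (C.jetIncl (le_refl (k + 1)))) ∧
      -- and is a surjective bimodule map, compatible with prolongation
      (∀ k : ℕ, Function.Surjective (π k)) ∧
      (∀ (k : ℕ) (a : A) (x : C.jetSpace (k + 1)), π k (a • x) = a • π k x) ∧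
      (∀ (k : ℕ) (a : A) (x : C.jetSpace (k + 1)),
        π k (MulOpposite.op a • x) = MulOpposite.op a • π k x) ∧
      (∀ (k : ℕ) (s : A), π k (j (k + 1) s) = j k s) := by
  have h : D.JetCompatible :=
    ⟨torsionFree, flat, wedgeCompatible, extendable, leibnizCompatible⟩
  refine ⟨h.leftModule, h.rightModule, h.prolong, C.jetProj, fun k => ⟨?_, ?_, ?_⟩,
    fun k i hi a ω => NCJet.BimoduleConnection.trunc_jet_odot_incl hi a ω.1,
    fun k i hi a ω => NCJet.BimoduleConnection.trunc_incl_odot_jet hi a ω.1,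
    h.coe_prolong, h.prolong_mul, fun k a s => h.prolong_mul k s a, fun k x i hi => ?_,
    C.ker_jetProj, C.jetProj_surjective, fun k a x => ?_, fun k a x => ?_, h.jetProj_prolong⟩
  · let := h.leftModule k
    let := h.rightModule k
    -- Left and right multiplications commute by associativity.
    exact ⟨fun a b x => (h.mul_assoc k _ _ _).symm⟩
  · let := h.leftModule k
    refine ⟨fun c a x => ?_⟩
    change h.mul k (h.prolong k (c • a)) x = c • h.mul k (h.prolong k a) x
    rw [map_smul, h.smul_mul]
  · let := h.rightModule k
    refine ⟨fun c a x => ?_⟩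
    change h.mul k x (h.prolong k (c • unop a)) = c • h.mul k x (h.prolong k (unop a))
    rw [map_smul, h.mul_smul]
  · rw [C.coe_jetProj, NCJet.DGA.trunc_apply, if_pos hi]
  · change C.jetProj k (h.mul (k + 1) (h.prolong (k + 1) a) x) =
      h.mul k (h.prolong k a) (C.jetProj k x)
    rw [h.jetProj_mul, h.jetProj_prolong]
  · change C.jetProj k (h.mul (k + 1) x (h.prolong (k + 1) a)) =
      h.mul k (C.jetProj k x) (h.prolong k a)
    rw [h.jetProj_mul, h.jetProj_prolong]
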